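/- Let $n\ge 1$ and $1\le k\le d-1$. Let $\mathcal G=(\{1,\dots,n\},\mathcal E)$ be a directed graph that is quasi-strongly connected, i.e. there is a node to which there is a directed path from every other node. Put $\mathcal N_i=\{j:(i,j)\in\mathcal E\}$ and let $a_{ij}>0$ for all $(i,j)\in\mathcal E$. Let $[I_k,0]^T\in\mathbb R^{d\times k}$ consist of the first $k$ columns of $I_d$. For $M\in\mathbb R^{d\times k}$ let $\mathrm{low}(M)\in\mathbb R^{d\times k}$ be its strictly lower triangular part, and let $\mathrm{up}(M)\in\mathbb R^{k\times k}$ be the upper triangular part (including the diagonal) of its first $k$ rows. The closed loop of Algorithm 1 is the system for $Q_i(t)\in\mathbb R^{d\times d}$ with $Q_i(0)\in\mathsf{SO}(d)$, and $R_i(t)\in\mathbb R^{k\times k}$, defined while all $R_i(t)$ are invertible, given for $i=1,\dots,n$ by $$\dot Q_i=Q_iU_i,\qquad \dot R_i=\mathrm{up}\big((V_i-U_i[I_k,0]^T)R_i\big),$$ $$V_i=\sum_{j\in\mathcal N_i}a_{ij}\big(Q_i^TQ_j[I_k,0]^TR_jR_i^{-1}-[I_k,0]^T\big),\qquad U_i=[\mathrm{low}(V_i),0]-[\mathrm{low}(V_i),0]^T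 .$$ Let $\mathcal R^+(k)$ be the set of upper triangular $k\times k$ matrices with positive diagonal elements, let $\mathcal D_{QR}(k)=(\mathsf{SO}(d)[I_k,0]^T)^n\times(\mathcal R^+(k))^n$ (an $ndk$-dimensional embedded submanifold of $(\mathbb R^{d\times k})^n\times(\mathbb R^{k\times k})^n$), and write $Q_i(t,k)=Q_i(t)[I_k,0]^T$. Let $\mathcal D_{QR,\mathrm{full}}(k)$ be the set of initial conditions $[Q(0,k),R(0)]\in\mathcal D_{QR}(k)$ such that, for every choice of $Q_i(0)\in\mathsf{SO}(d)$ whose first $k$ columns are $Q_i(0,k)$, $i=1,\dots,n$, the closed loop has a solution for all $t\ge 0$ with these initial values, and every such solution satisfies: 1. $[Q(t,k),R(t)]\in\mathcal D_{QR}(k)$ for all $t\ge0$; 2. there are $\bar Q\in\mathsf{SO}(d)$ and an invertible $\bar R\in\mathbb R^{k\times k}$ such that $\lim_{t\to\infty}Q_i(t,k)=\bar Q[I_k,0]^T$ and $\lim_{t\to\infty}R_i(t)=\bar R$ for all $i$. Then $\mathcal D_{QR,\mathrm{full}}(k)$ is open in $\mathcal D_{QR}(k)$, and $\mathcal D_{QR}(k)\setminus\mathcal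 D_{QR,\mathrm{full}}(k)$ has measure zero in the manifold $\mathcal D_{QR}(k)$ (equivalently, its $ndk$-dimensional Hausdorff measure is zero) and is nowhere dense in $\mathcal D_{QR}(k)$. -/

import Mathlib

open Filter Topology

noncomputable section

namespace ColumnSync

/-- `[I_k, 0]ᵀ`, the `d × k` matrix formed by the first `k` columns of the `d × d` identity. -/
def incl (d k : ℕ) : Matrix (Fin d) (Fin k) ℝ :=
  Matrix.of fun a b => if (a : ℕ) = (b : ℕ) then 1 else 0

/-- `low M`: the part of `M` strictly below the diagonal, of the same size as `M`. -/
def low {d k : ℕ} (M : Matrix (Fin d) (Fin k) ℝ) : Matrix (Fin d) (Fin k) ℝ :=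
  Matrix.of fun a b => if (b : ℕ) < (a : ℕ) then M a b else 0

/-- `up M`: the upper triangular part (with the diagonal) of a tall matrix `M`, as a square
matrix. -/
def up {d k : ℕ} (hkd : k ≤ d) (M : Matrix (Fin d) (Fin k) ℝ) : Matrix (Fin k) (Fin k) ℝ :=
  Matrix.of fun a b => if a ≤ b then M (Fin.castLE hkd a) b else 0

/-- The upper triangular `k × k` matrices with positive diagonal elements. -/
def RPlus (k : ℕ) : Set (Matrix (Fin k) (Fin k) ℝ) :=
  {R | (∀ a b, b < a → R a b = 0) ∧ ∀ a, 0 < R a a}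

/-- The ambient space of the pairs `[Q(t,k), R(t,k)]`: for each of the `n` agents a `d × k`
matrix and a `k × k` matrix. -/
abbrev State (n d k : ℕ) : Type :=
  (Fin n → Matrix (Fin d) (Fin k) ℝ) × (Fin n → Matrix (Fin k) (Fin k) ℝ)

/-- The set `D_QR(k) = (SO(d) [I_k, 0]ᵀ)ⁿ × (R⁺(k))ⁿ`. -/
def DQR (n d k : ℕ) : Set (State n d k) :=
  {p | (∀ i, ∃ P ∈ Matrix.specialOrthogonalGroup (Fin d) ℝ, p.1 i = P * incl d k) ∧
    ∀ i, p.2 i ∈ RPlus k}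

/-- A directed graph is quasi-strongly connected if it has a center: a node to which there is a
directed path from every other node. -/
def QuasiStronglyConnected {n : ℕ} (G : Digraph (Fin n)) : Prop :=
  ∃ r, ∀ i, Relation.ReflTransGen G.Adj i r

/-- The matrix `V_i = ∑_{j ∈ N_i} a_ij (Q_ij(k) R_ji - [I_k, 0]ᵀ)`, where `N_i` is the set of `j`
with an edge `(i, j)`, `Q_ij(k) = Q_iᵀ Q_j [I_k, 0]ᵀ` and `R_ji = R_j R_i⁻¹`. Here `Q j` is the full
rotation of agent `j`. -/
def V {n d k : ℕ} (G : Digraph (Fin n)) (w : Fin n → Fin n → ℝ)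
    (Q : Fin n → Matrix (Fin d) (Fin d) ℝ) (R : Fin n → Matrix (Fin k) (Fin k) ℝ) (i : Fin n) :
    Matrix (Fin d) (Fin k) ℝ :=
  open Classical in
  ∑ j ∈ Finset.univ.filter (fun j => G.Adj i j),
    w i j • ((Q i).transpose * (Q j * incl d k) * (R j * (R i)⁻¹) - incl d k)

/-- The controller `U_i(d) = [low V_i, 0] - [low V_i, 0]ᵀ`; the matrix `[X, 0]` is `X [I_k, 0]`. -/
def U {n d k : ℕ} (G : Digraph (Fin n)) (w : Fin n → Fin n → ℝ)
    (Q : Fin n → Matrix (Fin d) (Fin d) ℝ) (R : Fin n → Matrix (Fin k) (Fin k) ℝ) (i : Fin n) :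
    Matrix (Fin d) (Fin d) ℝ :=
  low (V G w Q R i) * (incl d k).transpose - (low (V G w Q R i) * (incl d k).transpose).transpose

/-- The right-hand side `up ((V_i - U_i(k)) R_i)` of the equation for `R_i`, where
`U_i(k) = U_i(d) [I_k, 0]ᵀ`. -/
def rhsR {n d k : ℕ} (hkd : k ≤ d) (G : Digraph (Fin n)) (w : Fin n → Fin n → ℝ)
    (Q : Fin n → Matrix (Fin d) (Fin d) ℝ) (R : Fin n → Matrix (Fin k) (Fin k) ℝ) (i : Fin n) :
    Matrix (Fin k) (Fin k) ℝ :=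
  up hkd ((V G w Q R i - U G w Q R i * incl d k) * R i)

/-- `(Q, R)` is a solution on `[0, ∞)` of the closed loop: every `R_i(t)` is invertible (the
controller is defined only then), `Q_i' = Q_i U_i(d)` and `R_i' = up ((V_i - U_i(k)) R_i)` for
all `t ≥ 0` (entrywise, one-sided at `t = 0`). -/
structure IsTrajectory {n d k : ℕ} (hkd : k ≤ d) (G : Digraph (Fin n)) (w : Fin n → Fin n → ℝ)
    (Q : ℝ → Fin n → Matrix (Fin d) (Fin d) ℝ) (R : ℝ → Fin n → Matrix (Fin k) (Fin k) ℝ) :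
    Prop where
  det_ne_zero : ∀ t, 0 ≤ t → ∀ i, (R t i).det ≠ 0
  deriv_Q : ∀ t, 0 ≤ t → ∀ i a b,
    HasDerivWithinAt (fun s => Q s i a b) ((Q t i * U G w (Q t) (R t) i) a b) (Set.Ici 0) t
  deriv_R : ∀ t, 0 ≤ t → ∀ i a b,
    HasDerivWithinAt (fun s => R s i a b) (rhsR hkd G w (Q t) (R t) i a b) (Set.Ici 0) t

/-- `(Q, R)` starts at the full rotations `P` and at the auxiliary matrices `R₀`. -/
def StartsAt {n d k : ℕ} (Q : ℝ → Fin n → Matrix (Fin d) (Fin d) ℝ)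
    (R : ℝ → Fin n → Matrix (Fin k) (Fin k) ℝ) (P : Fin n → Matrix (Fin d) (Fin d) ℝ)
    (R₀ : Fin n → Matrix (Fin k) (Fin k) ℝ) : Prop :=
  Q 0 = P ∧ R 0 = R₀

/-- `[Q(t,k), R(t,k)]` stays in `D_QR(k)`, and all `Q_i(t,k)` and all `R_i(t,k)` converge to a
common `Q̄ [I_k, 0]ᵀ` with `Q̄ ∈ SO(d)`, respectively to a common invertible `R̄`. -/
def StaysAndSynchronizes {n d k : ℕ} (Q : ℝ → Fin n → Matrix (Fin d) (Fin d) ℝ)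
    (R : ℝ → Fin n → Matrix (Fin k) (Fin k) ℝ) : Prop :=
  (∀ t, 0 ≤ t → ((fun i => Q t i * incl d k, R t) : State n d k) ∈ DQR n d k) ∧
  ∃ Qbar ∈ Matrix.specialOrthogonalGroup (Fin d) ℝ, ∃ Rbar : Matrix (Fin k) (Fin k) ℝ,
    Rbar.det ≠ 0 ∧ ∀ i,
      Tendsto (fun t => Q t i * incl d k) atTop (𝓝 (Qbar * incl d k)) ∧
      Tendsto (fun t => R t i) atTop (𝓝 Rbar)

/-- The set `D_QR,full(k)`. An initial condition prescribes only the first `k` columns of the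
rotations; whatever the full rotations `P i ∈ SO(d)` with these columns are, the closed loop has
a solution for all `t ≥ 0`, and every such solution stays in `D_QR(k)` and synchronizes. -/
def DQRFull {n d k : ℕ} (hkd : k ≤ d) (G : Digraph (Fin n)) (w : Fin n → Fin n → ℝ) :
    Set (State n d k) :=
  {p | p ∈ DQR n d k ∧
    ∀ P : Fin n → Matrix (Fin d) (Fin d) ℝ,
      (∀ i, P i ∈ Matrix.specialOrthogonalGroup (Fin d) ℝ ∧ P i * incl d k = p.1 i) →
      (∃ Q R, IsTrajectory hkd G w Q R ∧ StartsAt Q R P p.2) ∧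
      ∀ Q R, IsTrajectory hkd G w Q R → StartsAt Q R P p.2 → StaysAndSynchronizes Q R}

/-- The entries of a state, as a point of a real coordinate space (with its usual metric). -/
def entries {n d k : ℕ} (p : State n d k) :
    (Fin n → Fin d → Fin k → ℝ) × (Fin n → Fin k → Fin k → ℝ) :=
  (fun i a b => p.1 i a b, fun i a b => p.2 i a b)

/-- A subset of the submanifold `D_QR(k)` has measure zero: its Hausdorff measure of dimension
`dim D_QR(k) = n ((d k - k (k + 1) / 2) + k (k + 1) / 2) = n d k` vanishes. On an embedded
submanifold this is the same as being a null set in every chart, and it does not depend on which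
of the equivalent norms the ambient coordinate space carries. -/
def HasMeasureZero {n d k : ℕ} (S : Set (State n d k)) : Prop :=
  MeasureTheory.Measure.hausdorffMeasure ((n * d * k : ℕ) : ℝ) (entries '' S) = 0

end ColumnSync

end

/-!
Write `E = [I_k, 0]ᵀ`. Along the closed loop the products `X_i = Q_i E R_i` satisfy the linear
consensus equation `X_i' = ∑_j a_ij (X_j - X_i)`: the controller is designed so that
`V_i - U_i E` is upper triangular, and everything else cancels (`IsTrajectory.state_eq`). Hence
`X(t) = exp (t H) X(0)` with `H` the negative Laplacian, and since the graph has a center,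
`exp (t H)` converges to a matrix with equal rows `p` (`tendsto_exp_smul`).

Conversely, `(Q_i E, R_i)` is the QR decomposition of `X_i`. It is unique and depends smoothly on
`X_i` as long as `X_i` has full column rank (Gram–Schmidt). If `X_i(t)` keeps full rank, the columns
that the QR decomposition does not see are recovered from a linear differential equation with
continuous coefficients (`exists_rotation_lift`), so that the closed loop has a global solution
(`exists_trajectory`). Thus an initial condition is good exactly when all `X_i(t)`, `t ≥ 0`, and the
limit `∑_j p_j X_j(0)` have full rank (`mem_DQRFull_iff`).

This description gives everything. The matrices `exp (t H)`, `t ≥ 0`, and their limit form a compact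
set, so the condition is open. Rank-deficient `d × k` matrices have codimension `d - k + 1 ≥ 2`, and
the time parameter costs one dimension, so the exceptional tuples `X(0)` have Hausdorff dimension
less than `n d k` (`dimH_not_keepsFullRank_lt`). The locally Lipschitz map `X ↦ (Q E, R)` transports
this bound to `D_QR(k)`, whence measure zero; and the complement of a set of such dimension is
dense, which the continuity of the same map transports to `D_QR(k)`.
-/

noncomputable section

namespace ColumnSync

/-! ### Linear differential equations on a half-line -/

section

open Set

/-- Uniqueness for a linear equation with continuous coefficients. -/
theorem linearODE_unique {E : Type*} [NormedAddCommGroup E] [NormedSpace ℝ E]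
    {A : ℝ → E →L[ℝ] E} {T : ℝ} (hA : ContinuousOn A (Icc 0 T)) {q q' : ℝ → E}
    (hq : ∀ t ∈ Icc 0 T, HasDerivWithinAt q (A t (q t)) (Icc 0 T) t)
    (hq' : ∀ t ∈ Icc 0 T, HasDerivWithinAt q' (A t (q' t)) (Icc 0 T) t)
    (h0 : q 0 = q' 0) : EqOn q q' (Icc 0 T) := by
  obtain ⟨K, hK⟩ := isCompact_Icc.exists_bound_of_continuousOn hA
  have hd : ∀ t ∈ Icc 0 T,
      HasDerivWithinAt (q - q') (A t ((q - q') t)) (Icc 0 T) t := fun t ht => by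
    simpa using (hq t ht).sub (hq' t ht)
  have key := eq_zero_of_abs_deriv_le_mul_abs_self_of_eq_zero_right (K := K)
    (f := q - q') (f' := fun t => A t ((q - q') t)) (a := 0) (b := T)
    (fun t ht => (hd t ht).continuousWithinAt)
    (fun t ht => (hd t (Ico_subset_Icc_self ht)).mono_of_mem_nhdsWithin
      (mem_of_superset (Icc_mem_nhdsGE ht.2) (Icc_subset_Icc_left ht.1)))
    (by simp [h0])
    (fun t ht => ((A t).le_opNorm _).trans
      (mul_le_mul_of_nonneg_right (hK t (Ico_subset_Icc_self ht)) (norm_nonneg _)))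
  exact fun t ht => sub_eq_zero.mp (key t ht)

/-- The coordinatewise truncation to `[-ρ, ρ]`. -/
def clip {m : ℕ} (ρ : ℝ) (x : Fin m → ℝ) : Fin m → ℝ := fun i => max (-ρ) (min ρ (x i))

theorem lipschitzWith_clip {m : ℕ} (ρ : ℝ) : LipschitzWith 1 (clip (m := m) ρ) := by
  refine LipschitzWith.of_dist_le_mul fun x y => ?_
  rw [NNReal.coe_one, one_mul, dist_pi_le_iff dist_nonneg]
  intro i
  refine le_trans ?_ (dist_le_pi_dist x y i)
  simp only [clip, Real.dist_eq]
  have h1 := abs_max_sub_max_le_max (-ρ) (min ρ (x i)) (-ρ) (min ρ (y i))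
  have h2 := abs_min_sub_min_le_max ρ (x i) ρ (y i)
  simpa using h1.trans (max_le (by simp) (h2.trans (max_le (by simp) le_rfl)))

theorem norm_clip_le {m : ℕ} {ρ : ℝ} (hρ : 0 ≤ ρ) (x : Fin m → ℝ) : ‖clip ρ x‖ ≤ ‖x‖ := by
  have h := (lipschitzWith_clip ρ).dist_le_mul x 0
  have h0 : clip ρ (0 : Fin m → ℝ) = 0 := by ext i; simp [clip, hρ]
  simpa [h0] using h

theorem norm_clip_le_radius {m : ℕ} {ρ : ℝ} (hρ : 0 ≤ ρ) (x : Fin m → ℝ) : ‖clip ρ x‖ ≤ ρ := by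
  rw [pi_norm_le_iff_of_nonneg hρ]
  intro i
  rw [Real.norm_eq_abs, abs_le]
  exact ⟨le_max_left _ _, max_le (by linarith) (min_le_left _ _)⟩

theorem clip_eq_self {m : ℕ} {ρ : ℝ} {x : Fin m → ℝ} (hx : ‖x‖ ≤ ρ) : clip ρ x = x := by
  ext i
  have := abs_le.mp ((norm_le_pi_norm x i).trans hx)
  simp [clip, this.1, this.2]

/-- Existence on a compact interval: truncating the unknown makes the vector field bounded, so that
Picard–Lindelöf applies on the whole interval, and Grönwall's inequality shows that a truncation at
a large enough radius is never active. -/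
theorem linearODE_exists_Icc {m : ℕ} {A : ℝ → (Fin m → ℝ) →L[ℝ] (Fin m → ℝ)} {T : ℝ} (hT : 0 ≤ T)
    (hA : ContinuousOn A (Icc 0 T)) (x₀ : Fin m → ℝ) :
    ∃ q : ℝ → Fin m → ℝ, q 0 = x₀ ∧
      ∀ t ∈ Icc 0 T, HasDerivWithinAt q (A t (q t)) (Icc 0 T) t := by
  obtain ⟨K, hK⟩ := isCompact_Icc.exists_bound_of_continuousOn hA
  have hK0 : 0 ≤ K := (norm_nonneg _).trans (hK 0 ⟨le_rfl, hT⟩)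
  set ρ : ℝ := ‖x₀‖ * Real.exp (K * T) with hρ
  have hρ0 : 0 ≤ ρ := by positivity
  set f : ℝ → (Fin m → ℝ) → (Fin m → ℝ) := fun t x => A t (clip ρ x) with hf
  have hPL : IsPicardLindelof f (tmin := 0) (tmax := T) ⟨0, le_rfl, hT⟩ x₀
      ⟨K * ρ * T, by positivity⟩ 0 ⟨K * ρ, by positivity⟩ ⟨K, hK0⟩ := by
    refine ⟨fun t ht => ?_, fun x _ => ?_, fun t ht x _ => ?_, ?_⟩
    · have h1 : LipschitzWith ⟨K, hK0⟩ (A t) :=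
        (A t).lipschitz.weaken (hK t ht)
      have := h1.comp (lipschitzWith_clip (m := m) ρ)
      exact (this.weaken (mul_one _).le).lipschitzOnWith
    · exact hA.clm_apply continuousOn_const
    · exact ((A t).le_opNorm _).trans
        (mul_le_mul (hK t ht) (norm_clip_le_radius hρ0 x) (norm_nonneg _) hK0)
    · have hmax : max (T - 0) (0 - 0) = T := by simp [hT]
      change K * ρ * max (T - 0) (0 - 0) ≤ K * ρ * T - (0 : ℝ)
      rw [hmax, sub_zero]
  obtain ⟨q, hq0, hq⟩ := hPL.exists_eq_forall_mem_Icc_hasDerivWithinAt₀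
  refine ⟨q, hq0, fun t ht => ?_⟩
  have hb := norm_le_gronwallBound_of_norm_deriv_right_le (δ := ‖x₀‖) (K := K) (ε := 0)
    (f := q) (f' := fun t => f t (q t)) (a := 0) (b := T)
    (fun t ht => (hq t ht).continuousWithinAt)
    (fun t ht => (hq t (Ico_subset_Icc_self ht)).mono_of_mem_nhdsWithin
      (mem_of_superset (Icc_mem_nhdsGE ht.2) (Icc_subset_Icc_left ht.1)))
    (by rw [← hq0])
    (fun t ht => by
      rw [add_zero]
      exact ((A t).le_opNorm _).trans
        (mul_le_mul (hK t (Ico_subset_Icc_self ht)) (norm_clip_le hρ0 _) (norm_nonneg _) hK0))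
    t ht
  rw [gronwallBound_ε0, sub_zero] at hb
  have hle : ‖q t‖ ≤ ρ := hb.trans (by rw [hρ]; gcongr; exact ht.2)
  have := hq t ht
  simp only [hf, clip_eq_self hle] at this
  exact this

/-- Existence on `[0, ∞)`, by glueing the solutions on the intervals `[0, N + 1]`. -/
theorem linearODE_exists {m : ℕ} {A : ℝ → (Fin m → ℝ) →L[ℝ] (Fin m → ℝ)}
    (hA : ContinuousOn A (Ici 0)) (x₀ : Fin m → ℝ) :
    ∃ q : ℝ → Fin m → ℝ, q 0 = x₀ ∧
      ∀ t, 0 ≤ t → HasDerivWithinAt q (A t (q t)) (Ici 0) t := by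
  have hex : ∀ N : ℕ, ∃ q : ℝ → Fin m → ℝ, q 0 = x₀ ∧
      ∀ t ∈ Icc (0 : ℝ) (N + 1), HasDerivWithinAt q (A t (q t)) (Icc 0 ((N : ℝ) + 1)) t := fun N =>
    linearODE_exists_Icc (by positivity) (hA.mono Icc_subset_Ici_self) x₀
  choose α hα0 hα using hex
  have hcompat : ∀ N M : ℕ, N ≤ M → EqOn (α N) (α M) (Icc 0 ((N : ℝ) + 1)) := fun N M hNM => by
    have hsub : Icc (0 : ℝ) (N + 1) ⊆ Icc 0 ((M : ℝ) + 1) :=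
      Icc_subset_Icc_right (by have : (N : ℝ) ≤ M := by exact_mod_cast hNM
                               linarith)
    exact linearODE_unique (hA.mono Icc_subset_Ici_self) (hα N)
      (fun t ht => (hα M t (hsub ht)).mono hsub) (by rw [hα0, hα0])
  set q : ℝ → Fin m → ℝ := fun t => α ⌊t⌋₊ t with hq
  have hqα : ∀ N : ℕ, EqOn q (α N) (Icc 0 ((N : ℝ) + 1)) := fun N t ht => by
    rcases le_total ⌊t⌋₊ N with h | h
    · exact hcompat _ _ h ⟨ht.1, (Nat.lt_floor_add_one t).le⟩
    · exact (hcompat _ _ h ht).symm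
  refine ⟨q, by simp [hq, hα0], fun t ht => ?_⟩
  have htN : t < (⌊t⌋₊ : ℝ) + 1 := Nat.lt_floor_add_one t
  have hmem : t ∈ Icc (0 : ℝ) (⌊t⌋₊ + 1) := ⟨ht, htN.le⟩
  have h1 : HasDerivWithinAt q (A t (q t)) (Icc 0 ((⌊t⌋₊ : ℝ) + 1)) t :=
    (hα ⌊t⌋₊ t hmem).congr (fun s hs => hqα _ hs) (hqα _ hmem)
  refine h1.mono_of_mem_nhdsWithin ?_
  rw [← Ici_inter_Iic]
  exact inter_mem_nhdsWithin _ (Iic_mem_nhds htN)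

/-- The matrix-vector product as a continuous linear map depending linearly on the matrix. -/
def mulVecCLM (m : ℕ) : Matrix (Fin m) (Fin m) ℝ →ₗ[ℝ] ((Fin m → ℝ) →L[ℝ] (Fin m → ℝ)) :=
  LinearMap.toContinuousLinearMap.toLinearMap ∘ₗ Matrix.toLin'.toLinearMap

@[simp] theorem mulVecCLM_apply {m : ℕ} (M : Matrix (Fin m) (Fin m) ℝ) (x : Fin m → ℝ) :
    mulVecCLM m M x = M.mulVec x := by
  simp [mulVecCLM]

theorem continuous_mulVecCLM (m : ℕ) : Continuous (mulVecCLM m) :=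
  LinearMap.continuous_of_finiteDimensional _

/-- Two solutions on `[0, ∞)` of `Z' = Ω(t) Z`, for matrices given entrywise, agree if they have
the same initial value. -/
theorem matrixODE_unique {m l : ℕ} {Ω : ℝ → Matrix (Fin m) (Fin m) ℝ}
    (hΩ : ContinuousOn Ω (Ici 0)) {Z Z' : ℝ → Matrix (Fin m) (Fin l) ℝ}
    (hZ : ∀ t, 0 ≤ t → ∀ a b, HasDerivWithinAt (fun s => Z s a b) ((Ω t * Z t) a b) (Ici 0) t)
    (hZ' : ∀ t, 0 ≤ t → ∀ a b, HasDerivWithinAt (fun s => Z' s a b) ((Ω t * Z' t) a b) (Ici 0) t)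
    (h0 : Z 0 = Z' 0) {t : ℝ} (ht : 0 ≤ t) : Z t = Z' t := by
  ext a b
  have hsub : Icc 0 t ⊆ Ici (0 : ℝ) := Icc_subset_Ici_self
  have key := linearODE_unique (A := fun s => mulVecCLM m (Ω s)) (T := t)
    (q := fun s a => Z s a b) (q' := fun s a => Z' s a b)
    ((continuous_mulVecCLM m).comp_continuousOn (hΩ.mono hsub))
    (fun s hs => by
      rw [hasDerivWithinAt_pi]
      intro a
      exact (hZ s hs.1 a b).mono hsub)
    (fun s hs => by
      rw [hasDerivWithinAt_pi]
      intro a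
      exact (hZ' s hs.1 a b).mono hsub)
    (by simp [h0])
  exact congrFun (key ⟨ht, le_rfl⟩) a

theorem matrixODE_exists {m l : ℕ} {Ω : ℝ → Matrix (Fin m) (Fin m) ℝ}
    (hΩ : ContinuousOn Ω (Ici 0)) (Z₀ : Matrix (Fin m) (Fin l) ℝ) :
    ∃ Z : ℝ → Matrix (Fin m) (Fin l) ℝ, Z 0 = Z₀ ∧
      ∀ t, 0 ≤ t → ∀ a b, HasDerivWithinAt (fun s => Z s a b) ((Ω t * Z t) a b) (Ici 0) t := by
  have hex := fun b => linearODE_exists (A := fun s => mulVecCLM m (Ω s))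
    ((continuous_mulVecCLM m).comp_continuousOn hΩ) (fun a => Z₀ a b)
  choose q hq0 hq using hex
  refine ⟨fun t => Matrix.of fun a b => q b t a, ?_, fun t ht a b => ?_⟩
  · ext a b
    simp [hq0]
  · have := hasDerivWithinAt_pi.mp (hq b t ht) a
    simpa [Matrix.mulVec, dotProduct, Matrix.mul_apply] using this

end

/-! ### Exponentials of Metzler matrices and consensus -/

section

open scoped Matrix.Norms.Operator
open NormedSpace (exp)

section Consensus

variable {n : ℕ} {H : Matrix (Fin n) (Fin n) ℝ}

theorem hasDerivAt_exp_entry (H : Matrix (Fin n) (Fin n) ℝ) (t : ℝ) (i j : Fin n) :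
    HasDerivAt (fun s : ℝ => exp (s • H) i j) ((H * exp (t • H)) i j) t := by
  have h := hasDerivAt_exp_smul_const' (𝕂 := ℝ) H t
  have h1 := hasDerivAt_pi.mp h i
  exact hasDerivAt_pi.mp h1 j

theorem continuous_exp_smul (H : Matrix (Fin n) (Fin n) ℝ) :
    Continuous fun s : ℝ => exp (s • H) :=
  continuous_iff_continuousAt.mpr fun t =>
    (hasDerivAt_exp_smul_const' (𝕂 := ℝ) H t).continuousAt

theorem exp_add_smul (H : Matrix (Fin n) (Fin n) ℝ) (s t : ℝ) :
    exp ((s + t) • H) = exp (s • H) * exp (t • H) := by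
  rw [add_smul]
  exact Matrix.exp_add_of_commute _ _ (((Commute.refl H).smul_left s).smul_right t)

theorem pow_entry_nonneg {N : Matrix (Fin n) (Fin n) ℝ} (hN : ∀ i j, 0 ≤ N i j) (m : ℕ) :
    ∀ i j, 0 ≤ (N ^ m) i j := by
  induction m with
  | zero => intro i j; by_cases h : i = j <;> simp [h]
  | succ m ih =>
    intro i j
    rw [pow_succ, Matrix.mul_apply]
    exact Finset.sum_nonneg fun l _ => mul_nonneg (ih i l) (hN l j)

/-- Every entry of the exponential of an entrywise nonnegative matrix dominates the corresponding
entry of each term of the exponential series. -/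
theorem pow_entry_le_exp {N : Matrix (Fin n) (Fin n) ℝ} (hN : ∀ i j, 0 ≤ N i j) (m : ℕ)
    (i j : Fin n) : ((m.factorial : ℝ)⁻¹) * (N ^ m) i j ≤ exp N i j := by
  have h := NormedSpace.exp_series_hasSum_exp' (𝕂 := ℝ) N
  have h1 := Pi.hasSum.mp (Pi.hasSum.mp h i) j
  refine le_hasSum h1 m fun l _ => ?_
  exact mul_nonneg (by positivity) (pow_entry_nonneg hN l i j)

theorem exp_add_smul_one (N : Matrix (Fin n) (Fin n) ℝ) (c : ℝ) :
    exp (N + c • (1 : Matrix (Fin n) (Fin n) ℝ)) = Real.exp c • exp N := by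
  have hcomm : Commute N (c • (1 : Matrix (Fin n) (Fin n) ℝ)) := (Commute.one_right N).smul_right c
  rw [Matrix.exp_add_of_commute _ _ hcomm, Matrix.smul_one_eq_diagonal, Matrix.exp_diagonal]
  have : (exp fun _ : Fin n => c) = fun _ => Real.exp c := by
    ext i
    rw [Pi.coe_exp, Real.exp_eq_exp_ℝ]
  rw [this, ← Matrix.smul_one_eq_diagonal]
  simp

/-- Adding a large multiple of the identity makes a Metzler matrix (one with nonnegative
off-diagonal entries) entrywise nonnegative. -/
theorem exists_shift_nonneg (hoff : ∀ i j, i ≠ j → 0 ≤ H i j) :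
    ∃ c : ℝ, ∀ i j, H i j ≤ (H + c • (1 : Matrix (Fin n) (Fin n) ℝ)) i j ∧
      0 ≤ (H + c • (1 : Matrix (Fin n) (Fin n) ℝ)) i j := by
  refine ⟨∑ i, |H i i|, fun i j => ?_⟩
  have hi : |H i i| ≤ ∑ i, |H i i| :=
    Finset.single_le_sum (f := fun i => |H i i|) (fun _ _ => abs_nonneg _) (Finset.mem_univ i)
  by_cases h : i = j
  · subst h
    have := neg_abs_le (H i i)
    simp only [Matrix.add_apply, Matrix.smul_apply, Matrix.one_apply_eq, smul_eq_mul, mul_one]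
    constructor <;> linarith [abs_nonneg (H i i)]
  · simp [Matrix.one_apply_ne h, hoff i j h]

theorem exp_smul_nonneg (hoff : ∀ i j, i ≠ j → 0 ≤ H i j) {t : ℝ} (ht : 0 ≤ t) (i j : Fin n) :
    0 ≤ exp (t • H) i j := by
  obtain ⟨c, hc⟩ := exists_shift_nonneg hoff
  have hH : t • H = t • (H + c • (1 : Matrix (Fin n) (Fin n) ℝ)) +
      (-(t * c)) • (1 : Matrix (Fin n) (Fin n) ℝ) := by
    rw [smul_add, smul_smul, neg_smul, add_neg_cancel_right]
  rw [hH, exp_add_smul_one]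
  have h0 := pow_entry_le_exp (N := t • (H + c • (1 : Matrix (Fin n) (Fin n) ℝ)))
    (fun i j => mul_nonneg ht (hc i j).2) 0 i j
  refine mul_nonneg (Real.exp_pos _).le (le_trans ?_ h0)
  by_cases h : i = j <;> simp [h]

/-- If `r` can be reached from `i` along positive entries of `H`, then `exp H` has a positive
`(i, r)` entry. -/
theorem exp_pos_of_reachable (hoff : ∀ i j, i ≠ j → 0 ≤ H i j) {i r : Fin n}
    (hr : Relation.ReflTransGen (fun i j => 0 < H i j) i r) : 0 < exp H i r := by
  obtain ⟨c, hc⟩ := exists_shift_nonneg hoff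
  set N := H + c • (1 : Matrix (Fin n) (Fin n) ℝ) with hN
  have hH : H = N + (-c) • (1 : Matrix (Fin n) (Fin n) ℝ) := by
    rw [hN, neg_smul, add_neg_cancel_right]
  have hreach : ∃ m, 0 < (N ^ m) i r := by
    induction hr using Relation.ReflTransGen.head_induction_on with
    | refl => exact ⟨0, by simp⟩
    | @head a b h _ ih =>
      obtain ⟨m, hm⟩ := ih
      refine ⟨m + 1, ?_⟩
      rw [pow_succ', Matrix.mul_apply]
      refine lt_of_lt_of_le (mul_pos (h.trans_le (hc a b).1) hm)
        (Finset.single_le_sum (f := fun l => N a l * (N ^ m) l r)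
          (fun l _ => mul_nonneg (hc a l).2 (pow_entry_nonneg (fun i j => (hc i j).2) m l r))
          (Finset.mem_univ b))
  obtain ⟨m, hm⟩ := hreach
  rw [hH, exp_add_smul_one]
  refine mul_pos (Real.exp_pos _)
    (lt_of_lt_of_le ?_ (pow_entry_le_exp (fun i j => (hc i j).2) m i r))
  positivity

theorem sum_exp_smul_eq_one (hrow : ∀ i, ∑ j, H i j = 0) (t : ℝ) (i : Fin n) :
    ∑ j, exp (t • H) i j = 1 := by
  have hd : ∀ s : ℝ, HasDerivAt (fun s : ℝ => ∑ j, exp (s • H) i j) 0 s := fun s => by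
    have h := HasDerivAt.fun_sum (u := Finset.univ)
      fun (j : Fin n) _ => hasDerivAt_exp_entry H s i j
    have hcomm : H * exp (s • H) = exp (s • H) * H :=
      (((Commute.refl H).smul_right s).exp_right).eq
    have h0 : ∑ j, (H * exp (s • H)) i j = 0 := by
      rw [hcomm]
      simp only [Matrix.mul_apply]
      rw [Finset.sum_comm]
      simp [← Finset.mul_sum, hrow]
    rwa [h0] at h
  have hc := is_const_of_deriv_eq_zero (fun s => (hd s).differentiableAt) (fun s => (hd s).deriv) t 0
  rw [hc]
  simp [Matrix.one_apply]

theorem mul_le_of_stochastic {P : Matrix (Fin n) (Fin n) ℝ} (hP : ∀ i j, 0 ≤ P i j)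
    (hP1 : ∀ i, ∑ j, P i j = 1) {δ : ℝ} {r : Fin n} (hδ : ∀ i, δ ≤ P i r) {x : Fin n → ℝ} {M : ℝ}
    (hM : ∀ i, x i ≤ M) (i : Fin n) : ∑ j, P i j * x j ≤ M + δ * (x r - M) := by
  have h1 : ∑ j, P i j * x j = M + ∑ j, P i j * (x j - M) := by
    simp only [mul_sub, Finset.sum_sub_distrib, ← Finset.sum_mul, hP1]
    ring
  have h2 : ∑ j, P i j * (x j - M) ≤ P i r * (x r - M) := by
    rw [← Finset.add_sum_erase _ _ (Finset.mem_univ r)]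
    have : ∑ j ∈ Finset.univ.erase r, P i j * (x j - M) ≤ 0 :=
      Finset.sum_nonpos fun j _ => mul_nonpos_of_nonneg_of_nonpos (hP i j) (by linarith [hM j])
    linarith
  have h3 : P i r * (x r - M) ≤ δ * (x r - M) :=
    mul_le_mul_of_nonpos_right (hδ i) (by linarith [hM r])
  linarith

/-- The consensus theorem: if `H` is a Metzler matrix with vanishing row sums such that some index
can be reached from all others along positive entries, then `exp (t H)` converges to a matrix with
equal rows of sum one. The maximum of each column of `exp (t H)` is nonincreasing, and over a unit
of time the oscillation of a column contracts by a fixed factor, because `exp H` is a stochastic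
matrix with a positive column. -/
theorem tendsto_exp_smul (hoff : ∀ i j, i ≠ j → 0 ≤ H i j) (hrow : ∀ i, ∑ j, H i j = 0)
    {r : Fin n} (hr : ∀ i, Relation.ReflTransGen (fun i j => 0 < H i j) i r) :
    ∃ p : Fin n → ℝ, ∑ j, p j = 1 ∧
      ∀ i j, Tendsto (fun t : ℝ => exp (t • H) i j) atTop (𝓝 (p j)) := by
  have hne : Nonempty (Fin n) := ⟨r⟩
  obtain ⟨i₀, hi₀⟩ := Finite.exists_min fun i => exp H i r
  set δ := exp H i₀ r with hδ
  have hδ0 : 0 < δ := exp_pos_of_reachable hoff (hr i₀)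
  have hnn := fun {t : ℝ} (ht : 0 ≤ t) => exp_smul_nonneg hoff ht
  have hsum := sum_exp_smul_eq_one hrow
  have hcol : ∀ j, ∃ p, ∀ i, Tendsto (fun t : ℝ => exp (t • H) i j) atTop (𝓝 p) := by
    intro j
    set x : ℝ → Fin n → ℝ := fun t i => exp (t • H) i j with hx
    have hxadd : ∀ s t i, x (s + t) i = ∑ l, exp (s • H) i l * x t l := fun s t i => by
      simp only [hx]
      rw [exp_add_smul, Matrix.mul_apply]
    -- Minima of the column `j` are treated as maxima of its negative.
    have general : ∀ y : ℝ → Fin n → ℝ,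
        (∀ s t i, y (s + t) i = ∑ l, exp (s • H) i l * y t l) →
        Antitone (fun t => ⨆ i, y t i) := by
      intro y hy s t hst
      refine ciSup_le fun i => ?_
      have h := mul_le_of_stochastic (hnn (sub_nonneg.mpr hst)) (hsum (t - s))
        (r := r) (fun i => hnn (sub_nonneg.mpr hst) i r) (x := y s)
        (fun i => le_ciSup (Set.finite_range (y s)).bddAbove i) i
      rw [← hy, sub_add_cancel, zero_mul, add_zero] at h
      exact h
    set M : ℝ → ℝ := fun t => ⨆ i, x t i with hM
    set m : ℝ → ℝ := fun t => ⨆ i, -x t i with hm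
    have hMa : Antitone M := general x hxadd
    have hma : Antitone m := general (fun t i => -x t i) fun s t i => by
      simp [hxadd s t i]
    have hxM : ∀ t i, x t i ≤ M t := fun t i => le_ciSup (Set.finite_range (x t)).bddAbove i
    have hxm : ∀ t i, -x t i ≤ m t := fun t i =>
      le_ciSup (Set.finite_range fun i => -x t i).bddAbove i
    have hcontr : ∀ t, M (1 + t) + m (1 + t) ≤ (1 - δ) * (M t + m t) := by
      intro t
      have hδ' : ∀ i, δ ≤ exp ((1 : ℝ) • H) i r := fun i => by rw [one_smul]; exact hi₀ i
      have h1 : M (1 + t) ≤ M t + δ * (x t r - M t) := ciSup_le fun i => by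
        rw [hxadd]
        exact mul_le_of_stochastic (hnn zero_le_one) (hsum 1) hδ' (hxM t) i
      have h2 : m (1 + t) ≤ m t + δ * (-x t r - m t) := ciSup_le fun i => by
        have := mul_le_of_stochastic (hnn zero_le_one) (hsum 1) hδ' (hxm t) i
        rw [hxadd]
        simpa using this
      linarith
    -- A nonincreasing function that stays above `-g` for a nonincreasing `g` converges.
    have hbdd : ∀ f g : ℝ → ℝ, Antitone f → Antitone g → (∀ t, 0 ≤ f t + g t) →
        ∃ l, Tendsto f atTop (𝓝 l) := by
      intro f g hf hg hfg
      rcases tendsto_atTop_of_antitone hf with h | h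
      · obtain ⟨t, ht0, ht⟩ := ((h.eventually (eventually_lt_atBot (-g 0))).and
          (eventually_ge_atTop 0)).exists
        linarith [hfg t, hg ht]
      · exact h
    have hosc : ∀ t, 0 ≤ M t + m t := fun t => by linarith [hxM t r, hxm t r]
    obtain ⟨p, hp⟩ := hbdd M m hMa hma hosc
    obtain ⟨p', hp'⟩ := hbdd m M hma hMa fun t => by linarith [hosc t]
    have hshift : Tendsto (fun t : ℝ => 1 + t) atTop atTop :=
      tendsto_atTop_add_const_left _ _ tendsto_id
    have hle : p + p' ≤ (1 - δ) * (p + p') :=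
      le_of_tendsto_of_tendsto' ((hp.comp hshift).add (hp'.comp hshift))
        ((hp.add hp').const_mul (1 - δ)) hcontr
    have hge : 0 ≤ p + p' := ge_of_tendsto' (hp.add hp') hosc
    have hpp : p' = -p := by nlinarith
    refine ⟨p, fun i => tendsto_of_tendsto_of_tendsto_of_le_of_le (g := fun t => -m t) ?_ hp
      (fun t => by linarith [hxm t i]) (fun t => hxM t i)⟩
    simpa [hpp] using hp'.neg
  choose p hp using hcol
  refine ⟨p, ?_, fun i j => hp j i⟩
  have h := tendsto_finsetSum Finset.univ fun j _ => hp j r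
  simp only [hsum] at h
  exact tendsto_nhds_unique h tendsto_const_nhds

end Consensus

end

/-! ### The QR decomposition of a matrix of full column rank -/

section

open InnerProductSpace

/-- A `d × k` matrix has full column rank; the Gram determinant makes this an open condition. -/
def FullRank {d k : ℕ} (X : Matrix (Fin d) (Fin k) ℝ) : Prop := (X.transpose * X).det ≠ 0

/-- The columns of a matrix, as vectors of Euclidean space. -/
def cols {d k : ℕ} (X : Matrix (Fin d) (Fin k) ℝ) (b : Fin k) : EuclideanSpace ℝ (Fin d) :=
  WithLp.toLp 2 fun a => X a b

/-- The orthonormal factor of the QR decomposition: Gram–Schmidt applied to the columns. -/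
def qFac {d k : ℕ} (X : Matrix (Fin d) (Fin k) ℝ) : Matrix (Fin d) (Fin k) ℝ :=
  Matrix.of fun a b => gramSchmidtNormed ℝ (cols X) b a

/-- The triangular factor of the QR decomposition. -/
def rFac {d k : ℕ} (X : Matrix (Fin d) (Fin k) ℝ) : Matrix (Fin k) (Fin k) ℝ :=
  (qFac X).transpose * X

section QR

variable {d k : ℕ} {X : Matrix (Fin d) (Fin k) ℝ}

theorem inner_cols {l : ℕ} (X : Matrix (Fin d) (Fin k) ℝ) (Y : Matrix (Fin d) (Fin l) ℝ)
    (a : Fin k) (b : Fin l) : inner ℝ (cols X a) (cols Y b) = (X.transpose * Y) a b := by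
  simp [cols, PiLp.inner_apply, Matrix.mul_apply, mul_comm]

theorem cols_qFac (X : Matrix (Fin d) (Fin k) ℝ) (b : Fin k) :
    cols (qFac X) b = gramSchmidtNormed ℝ (cols X) b := rfl

theorem FullRank.linearIndependent (hX : FullRank X) : LinearIndependent ℝ (cols X) := by
  rw [Fintype.linearIndependent_iff]
  intro g hg
  have h0 : X.mulVec g = 0 := by
    ext a
    have := congrArg (fun v : EuclideanSpace ℝ (Fin d) => v a) hg
    simpa [cols, Matrix.mulVec, dotProduct, mul_comm] using this
  have h1 : (X.transpose * X).mulVec g = 0 := by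
    rw [← Matrix.mulVec_mulVec, h0, Matrix.mulVec_zero]
  exact congrFun (Matrix.eq_zero_of_mulVec_eq_zero hX h1)

theorem exists_mulVec_eq_zero_of_not_fullRank (hX : ¬ FullRank X) :
    ∃ v : Fin k → ℝ, v ≠ 0 ∧ X.mulVec v = 0 := by
  obtain ⟨v, hv, h⟩ := Matrix.exists_mulVec_eq_zero_iff.mpr (not_not.mp hX)
  refine ⟨v, hv, dotProduct_self_eq_zero.mp ?_⟩
  rw [← Matrix.mulVec_mulVec, Matrix.mulVec_transpose] at h
  rw [Matrix.dotProduct_mulVec, h, zero_dotProduct]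

theorem orthonormal_cols_iff : Orthonormal ℝ (cols X) ↔ X.transpose * X = 1 := by
  rw [orthonormal_iff_ite]
  constructor
  · intro h
    ext a b
    rw [← inner_cols, h, Matrix.one_apply]
  · intro h a b
    rw [inner_cols, h, Matrix.one_apply]

theorem FullRank.qFac_transpose_mul (hX : FullRank X) : (qFac X).transpose * qFac X = 1 := by
  rw [← orthonormal_cols_iff]
  exact gramSchmidtNormed_orthonormal hX.linearIndependent

theorem FullRank.rFac_mem (hX : FullRank X) : rFac X ∈ RPlus k := by
  have hr : ∀ a b, rFac X a b = ‖gramSchmidt ℝ (cols X) a‖⁻¹ *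
      inner ℝ (gramSchmidt ℝ (cols X) a) (cols X b) := fun a b => by
    rw [rFac, ← inner_cols, cols_qFac, gramSchmidtNormed, real_inner_smul_left]
    rfl
  refine ⟨fun a b hba => ?_, fun a => ?_⟩
  · rw [hr, gramSchmidt_inv_triangular ℝ _ hba, mul_zero]
  · have hne := gramSchmidt_ne_zero (𝕜 := ℝ) a hX.linearIndependent
    have hin : inner ℝ (gramSchmidt ℝ (cols X) a) (cols X a) =
        ‖gramSchmidt ℝ (cols X) a‖ ^ 2 := by
      conv_lhs => rw [gramSchmidt_def'' ℝ (cols X) a]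
      rw [inner_add_right, inner_sum, real_inner_self_eq_norm_sq]
      simp only [add_eq_left]
      refine Finset.sum_eq_zero fun i hi => ?_
      rw [real_inner_smul_right, gramSchmidt_orthogonal ℝ _ (Finset.mem_Iio.mp hi).ne', mul_zero]
    rw [hr, hin]
    have := norm_pos_iff.mpr hne
    positivity

theorem FullRank.qFac_mul_rFac (hX : FullRank X) : qFac X * rFac X = X := by
  have horth := gramSchmidtNormed_orthonormal (𝕜 := ℝ) hX.linearIndependent
  ext a b
  have hmem : cols X b ∈ Submodule.span ℝ (Set.range (gramSchmidtNormed ℝ (cols X))) := by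
    rw [span_gramSchmidtNormed_range, span_gramSchmidt]
    exact Submodule.subset_span ⟨b, rfl⟩
  obtain ⟨c, hc⟩ := (Submodule.mem_span_range_iff_exists_fun ℝ).mp hmem
  have hcoef : ∀ i, c i = rFac X i b := fun i => by
    rw [rFac, ← inner_cols, cols_qFac, ← hc, horth.inner_right_fintype]
  have := congrArg (fun v : EuclideanSpace ℝ (Fin d) => v a) hc
  simp only [WithLp.ofLp_sum, WithLp.ofLp_smul, Finset.sum_apply, Pi.smul_apply, hcoef] at this
  rw [Matrix.mul_apply]
  simpa [qFac, cols, mul_comm] using this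

theorem RPlus.blockTriangular {R : Matrix (Fin k) (Fin k) ℝ} (hR : R ∈ RPlus k) :
    R.BlockTriangular id := fun a b h => hR.1 a b h

theorem RPlus.det_pos {R : Matrix (Fin k) (Fin k) ℝ} (hR : R ∈ RPlus k) : 0 < R.det := by
  rw [Matrix.det_of_isUpperTriangular (RPlus.blockTriangular hR)]
  exact Finset.prod_pos fun a _ => hR.2 a

theorem fullRank_mul {C : Matrix (Fin d) (Fin k) ℝ} (hC : C.transpose * C = 1)
    {R : Matrix (Fin k) (Fin k) ℝ} (hR : R.det ≠ 0) : FullRank (C * R) := by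
  have : (C * R).transpose * (C * R) = R.transpose * R := by
    rw [Matrix.transpose_mul, Matrix.mul_assoc, ← Matrix.mul_assoc C.transpose, hC, Matrix.one_mul]
  rw [FullRank, this, Matrix.det_mul, Matrix.det_transpose]
  exact mul_ne_zero hR hR

/-- The only orthogonal upper triangular matrix with positive diagonal is the identity. -/
theorem eq_one_of_orthogonal_of_triangular {T : Matrix (Fin k) (Fin k) ℝ}
    (hT : T.BlockTriangular id) (hpos : ∀ a, 0 < T a a) (h : T.transpose * T = 1) : T = 1 := by
  have hinv : T⁻¹ = T.transpose := Matrix.inv_eq_left_inv h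
  have : Invertible T := Matrix.invertibleOfIsUnitDet _ (Matrix.isUnit_det_of_left_inverse h)
  have hT' : T.transpose.BlockTriangular id := by
    rw [← hinv]
    exact Matrix.blockTriangular_inv_of_blockTriangular hT
  have hoff : ∀ a b, a ≠ b → T a b = 0 := fun a b hab => by
    rcases lt_or_gt_of_ne hab with hlt | hlt
    · exact hT' hlt
    · exact hT hlt
  ext a b
  by_cases hab : a = b
  · subst hab
    have h1 := congrFun (congrFun h a) a
    rw [Matrix.mul_apply, Finset.sum_eq_single a (fun c _ hc => by simp [hoff c a hc])
      (by simp), Matrix.one_apply_eq, Matrix.transpose_apply] at h1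
    rw [Matrix.one_apply_eq]
    nlinarith [hpos a]
  · rw [hoff a b hab, Matrix.one_apply_ne hab]

/-- Uniqueness of the QR decomposition. -/
theorem qr_unique {C C' : Matrix (Fin d) (Fin k) ℝ} (hC : C.transpose * C = 1)
    (hC' : C'.transpose * C' = 1) {R R' : Matrix (Fin k) (Fin k) ℝ} (hR : R ∈ RPlus k)
    (hR' : R' ∈ RPlus k) (h : C * R = C' * R') : C = C' ∧ R = R' := by
  have hu : IsUnit R.det := (RPlus.det_pos hR).ne'.isUnit
  have hu' : IsUnit R'.det := (RPlus.det_pos hR').ne'.isUnit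
  have : Invertible R' := Matrix.invertibleOfIsUnitDet _ hu'
  have hbt' := Matrix.blockTriangular_inv_of_blockTriangular (RPlus.blockTriangular hR')
  set T := R * R'⁻¹ with hT
  have hTR : T * R' = R := by rw [hT, Matrix.mul_assoc, Matrix.nonsing_inv_mul _ hu', Matrix.mul_one]
  have hCT : C * T = C' := by
    rw [hT, ← Matrix.mul_assoc, h, Matrix.mul_assoc, Matrix.mul_nonsing_inv _ hu', Matrix.mul_one]
  have hTT : T.transpose * T = 1 := by
    rw [← hC', ← hCT, C.transpose_mul, Matrix.mul_assoc, ← Matrix.mul_assoc C.transpose, hC,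
      Matrix.one_mul]
  have hTbt : T.BlockTriangular id := (RPlus.blockTriangular hR).mul hbt'
  have hdiag : ∀ a, 0 < T a a := fun a => by
    have h1 : R a a = T a a * R' a a := by
      rw [← hTR, Matrix.mul_apply, Finset.sum_eq_single a]
      · intro c _ hc
        rcases lt_or_gt_of_ne hc with hlt | hlt
        · rw [hTbt hlt, zero_mul]
        · rw [RPlus.blockTriangular hR' hlt, mul_zero]
      · simp
    have h2 := hR.2 a
    rw [h1] at h2
    exact pos_of_mul_pos_left h2 (hR'.2 a).le
  have hT1 := eq_one_of_orthogonal_of_triangular hTbt hdiag hTT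
  rw [hT1] at hTR hCT
  exact ⟨by rw [← hCT, Matrix.mul_one], by rw [← hTR, Matrix.one_mul]⟩

theorem qFac_rFac_mul {C : Matrix (Fin d) (Fin k) ℝ} (hC : C.transpose * C = 1)
    {R : Matrix (Fin k) (Fin k) ℝ} (hR : R ∈ RPlus k) :
    qFac (C * R) = C ∧ rFac (C * R) = R := by
  have hfull := fullRank_mul hC (RPlus.det_pos hR).ne'
  exact qr_unique hfull.qFac_transpose_mul hC hfull.rFac_mem hR hfull.qFac_mul_rFac

/-! ### Smoothness of the QR decomposition -/

theorem contDiff_cols (b : Fin k) :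
    ContDiff ℝ 2 fun Y : Fin d → Fin k → ℝ => cols (Matrix.of Y) b := by
  unfold cols
  rw [contDiff_euclidean]
  intro a
  simp only [Matrix.of_apply]
  fun_prop

theorem contDiffAt_gramSchmidt (hX : FullRank X) (b : Fin k) :
    ContDiffAt ℝ 2 (fun Y : Fin d → Fin k → ℝ => gramSchmidt ℝ (cols (Matrix.of Y)) b) X := by
  induction b using WellFoundedLT.induction with
  | ind b ih =>
    have hrw : (fun Y : Fin d → Fin k → ℝ => gramSchmidt ℝ (cols (Matrix.of Y)) b) = fun Y =>
        cols (Matrix.of Y) b - ∑ i ∈ Finset.Iio b,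
          (inner ℝ (gramSchmidt ℝ (cols (Matrix.of Y)) i) (cols (Matrix.of Y) b) /
            ‖gramSchmidt ℝ (cols (Matrix.of Y)) i‖ ^ 2) • gramSchmidt ℝ (cols (Matrix.of Y)) i := by
      ext1 Y
      rw [eq_sub_iff_add_eq]
      exact (gramSchmidt_def'' ℝ (cols (Matrix.of Y)) b).symm
    rw [hrw]
    refine (contDiff_cols b).contDiffAt.sub (ContDiffAt.sum fun i hi => ?_)
    have hgs := ih i (Finset.mem_Iio.mp hi)
    have hne := gramSchmidt_ne_zero (𝕜 := ℝ) i hX.linearIndependent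
    exact ((hgs.inner ℝ (contDiff_cols b).contDiffAt).div (hgs.norm_sq ℝ)
      (pow_ne_zero 2 (norm_ne_zero_iff.mpr hne))).smul hgs

theorem contDiffAt_qFac (hX : FullRank X) (a : Fin d) (b : Fin k) :
    ContDiffAt ℝ 2 (fun Y : Fin d → Fin k → ℝ => qFac (Matrix.of Y) a b) X := by
  have h1 := contDiffAt_gramSchmidt hX b
  have hne := gramSchmidt_ne_zero (𝕜 := ℝ) b hX.linearIndependent
  have h2 : ContDiffAt ℝ 2
      (fun Y : Fin d → Fin k → ℝ => gramSchmidtNormed ℝ (cols (Matrix.of Y)) b) X :=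
    ((h1.norm ℝ hne).inv (norm_ne_zero_iff.mpr hne)).smul h1
  exact contDiffAt_euclidean.mp h2 a

theorem contDiffAt_rFac (hX : FullRank X) (a b : Fin k) :
    ContDiffAt ℝ 2 (fun Y : Fin d → Fin k → ℝ => rFac (Matrix.of Y) a b) X := by
  simp only [rFac, Matrix.mul_apply, Matrix.transpose_apply]
  refine ContDiffAt.sum fun c _ => (contDiffAt_qFac hX c a).mul ?_
  simp only [Matrix.of_apply]
  fun_prop

theorem isOpen_fullRank : IsOpen {X : Matrix (Fin d) (Fin k) ℝ | FullRank X} := by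
  refine isOpen_ne_fun ?_ continuous_const
  fun_prop

end QR

/-! ### Orthonormal columns and special orthogonal matrices -/

section SpecialOrthogonal

variable {d k : ℕ}

theorem mul_incl_apply {m : ℕ} (hkd : k ≤ d) (P : Matrix (Fin m) (Fin d) ℝ) (a : Fin m)
    (b : Fin k) : (P * incl d k) a b = P a (Fin.castLE hkd b) := by
  rw [Matrix.mul_apply, Finset.sum_eq_single (Fin.castLE hkd b)]
  · simp [incl]
  · intro c _ hc
    have : (c : ℕ) ≠ b := fun h => hc (Fin.ext h)
    simp [incl, this]
  · simp

theorem incl_transpose_mul_incl (hkd : k ≤ d) : (incl d k).transpose * incl d k = 1 := by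
  ext a b
  rw [mul_incl_apply hkd]
  simp [incl, Matrix.one_apply, Fin.ext_iff, eq_comm]

theorem mem_specialOrthogonal_iff {P : Matrix (Fin d) (Fin d) ℝ} :
    P ∈ Matrix.specialOrthogonalGroup (Fin d) ℝ ↔ P.transpose * P = 1 ∧ P.det = 1 := by
  rw [Matrix.mem_specialOrthogonalGroup_iff, Matrix.mem_orthogonalGroup_iff']

theorem transpose_mul_self_mul_incl (hkd : k ≤ d) {P : Matrix (Fin d) (Fin d) ℝ}
    (hP : P.transpose * P = 1) : (P * incl d k).transpose * (P * incl d k) = 1 := by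
  rw [Matrix.transpose_mul, Matrix.mul_assoc, ← Matrix.mul_assoc P.transpose, hP, Matrix.one_mul,
    incl_transpose_mul_incl hkd]

/-- As `k < d`, any `k` orthonormal columns are the first columns of a special orthogonal matrix:
the sign of the determinant is corrected in the last column. -/
theorem exists_specialOrthogonal_mul_incl (hkd : k < d) {C : Matrix (Fin d) (Fin k) ℝ}
    (hC : C.transpose * C = 1) :
    ∃ P ∈ Matrix.specialOrthogonalGroup (Fin d) ℝ, P * incl d k = C := by
  set v : Fin d → EuclideanSpace ℝ (Fin d) := fun a =>
    if h : (a : ℕ) < k then cols C ⟨a, h⟩ else 0 with hv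
  have hon := orthonormal_cols_iff.mpr hC
  have hvon : Orthonormal ℝ (Set.domRestrict {a : Fin d | (a : ℕ) < k} v) := by
    have h1 : Set.domRestrict {a : Fin d | (a : ℕ) < k} v =
        cols C ∘ fun a : {a : Fin d | (a : ℕ) < k} => (⟨a.1, a.2⟩ : Fin k) := by
      ext1 a
      have : ((a : Fin d) : ℕ) < k := a.2
      simp [hv, Set.domRestrict, this]
    rw [h1]
    exact hon.comp _ fun a b h => Subtype.ext (Fin.ext (Fin.mk.inj h))
  obtain ⟨e, he⟩ := hvon.exists_orthonormalBasis_extension_of_card_eq (by simp)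
  set P : Matrix (Fin d) (Fin d) ℝ := Matrix.of fun a b => e b a with hP
  have hPcols : cols P = e := rfl
  have hPP : P.transpose * P = 1 := by
    rw [← orthonormal_cols_iff, hPcols]
    exact e.orthonormal
  have hPC : ∀ a (b : Fin k), P a (Fin.castLE hkd.le b) = C a b := fun a b => by
    have hb : ((Fin.castLE hkd.le b : Fin d) : ℕ) < k := b.2
    have := he _ hb
    simp [hP, this, hv, cols]
  have hdet : P.det = 1 ∨ P.det = -1 := by
    have h := congrArg Matrix.det hPP
    rw [Matrix.det_mul, Matrix.det_transpose, Matrix.det_one] at h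
    exact mul_self_eq_one_iff.mp h
  rcases hdet with hdet | hdet
  · refine ⟨P, mem_specialOrthogonal_iff.mpr ⟨hPP, hdet⟩, ?_⟩
    ext a b
    rw [mul_incl_apply hkd.le, hPC]
  · set last : Fin d := ⟨d - 1, by omega⟩ with hlast
    set D : Fin d → ℝ := fun a => if a = last then -1 else 1 with hD
    have hDD : Matrix.diagonal D * Matrix.diagonal D = 1 := by
      rw [Matrix.diagonal_mul_diagonal, ← Matrix.diagonal_one]
      congr 1
      ext a
      by_cases h : a = last <;> simp [hD, h]
    refine ⟨P * Matrix.diagonal D, mem_specialOrthogonal_iff.mpr ⟨?_, ?_⟩, ?_⟩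
    · rw [Matrix.transpose_mul, Matrix.mul_assoc, ← Matrix.mul_assoc P.transpose, hPP,
        Matrix.one_mul, Matrix.diagonal_transpose, hDD]
    · rw [Matrix.det_mul, hdet, Matrix.det_diagonal]
      simp [hD, Finset.prod_ite_eq']
    · ext a b
      have hb : (Fin.castLE hkd.le b : Fin d) ≠ last := fun h => by
        have := congrArg Fin.val h
        simp [hlast] at this
        omega
      rw [mul_incl_apply hkd.le, Matrix.mul_diagonal, hPC]
      simp [hD, hb]

end SpecialOrthogonal

end

/-! ### The states `Q_i [I_k, 0]ᵀ R_i` of a trajectory solve a linear consensus equation -/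

section

open Set
open NormedSpace (exp)

/-- The generator of the consensus flow, the negative of the weighted graph Laplacian. -/
def gen {n : ℕ} (G : Digraph (Fin n)) (w : Fin n → Fin n → ℝ) : Matrix (Fin n) (Fin n) ℝ :=
  open Classical in
  Matrix.of (fun i j => if G.Adj i j then w i j else 0) -
    Matrix.diagonal fun i => ∑ j, if G.Adj i j then w i j else 0

/-- The action of an `n × n` matrix on `n`-tuples of matrices. -/
def mix {n d k : ℕ} (A : Matrix (Fin n) (Fin n) ℝ) (X : Fin n → Matrix (Fin d) (Fin k) ℝ)
    (i : Fin n) : Matrix (Fin d) (Fin k) ℝ := ∑ j, A i j • X j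

section Graph

variable {n : ℕ} {G : Digraph (Fin n)} {w : Fin n → Fin n → ℝ}

theorem gen_row_sum (i : Fin n) : ∑ j, gen G w i j = 0 := by
  classical
  simp [gen, Matrix.diagonal_apply, Finset.sum_sub_distrib]

theorem gen_of_ne {i j : Fin n} (h : i ≠ j) [Decidable (G.Adj i j)] :
    gen G w i j = if G.Adj i j then w i j else 0 := by
  simp [gen, h]

theorem gen_offdiag_nonneg (hw : ∀ i j, G.Adj i j → 0 < w i j) (i j : Fin n) (h : i ≠ j) :
    0 ≤ gen G w i j := by
  classical
  rw [gen_of_ne h]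
  split_ifs with hadj
  · exact (hw i j hadj).le
  · exact le_rfl

theorem gen_reachable (hw : ∀ i j, G.Adj i j → 0 < w i j) {i r : Fin n}
    (hr : Relation.ReflTransGen G.Adj i r) :
    Relation.ReflTransGen (fun i j => 0 < gen G w i j) i r := by
  classical
  induction hr using Relation.ReflTransGen.head_induction_on with
  | refl => exact .refl
  | @head a b h _ ih =>
    by_cases hab : a = b
    · rwa [hab]
    · refine .head ?_ ih
      rw [gen_of_ne hab, if_pos h]
      exact hw a b h

end Graph

section Mix

variable {n d k : ℕ}

theorem mix_apply (A : Matrix (Fin n) (Fin n) ℝ) (X : Fin n → Matrix (Fin d) (Fin k) ℝ)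
    (i : Fin n) (a : Fin d) (b : Fin k) : mix A X i a b = ∑ j, A i j * X j a b := by
  simp [mix, Matrix.sum_apply]

theorem mix_mul (A B : Matrix (Fin n) (Fin n) ℝ) (X : Fin n → Matrix (Fin d) (Fin k) ℝ) :
    mix (A * B) X = mix A (mix B X) := by
  ext i a b
  simp only [mix_apply, Matrix.mul_apply, Finset.sum_mul, Finset.mul_sum]
  rw [Finset.sum_comm]
  simp only [mul_assoc]

theorem mix_one (X : Fin n → Matrix (Fin d) (Fin k) ℝ) : mix 1 X = X := by
  ext i a b
  simp [mix_apply, Matrix.one_apply]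

end Mix

section Algebra

variable {d k : ℕ}

theorem incl_mul_apply_of_lt (M : Matrix (Fin k) (Fin k) ℝ) {a : Fin d} (b : Fin k)
    (ha : (a : ℕ) < k) : (incl d k * M) a b = M ⟨a, ha⟩ b := by
  rw [Matrix.mul_apply, Finset.sum_eq_single ⟨a, ha⟩]
  · simp [incl]
  · intro c _ hc
    have : (a : ℕ) ≠ c := fun h => hc (Fin.ext h.symm)
    simp [incl, this]
  · simp

theorem incl_mul_apply_of_le (M : Matrix (Fin k) (Fin k) ℝ) {a : Fin d} (b : Fin k)
    (ha : k ≤ (a : ℕ)) : (incl d k * M) a b = 0 := by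
  rw [Matrix.mul_apply]
  refine Finset.sum_eq_zero fun c _ => ?_
  have : (a : ℕ) ≠ c := by have := c.2; omega
  simp [incl, this]

theorem incl_mul_up (hkd : k ≤ d) {M : Matrix (Fin d) (Fin k) ℝ}
    (hM : ∀ (a : Fin d) (b : Fin k), (b : ℕ) < a → M a b = 0) : incl d k * up hkd M = M := by
  ext a b
  by_cases ha : (a : ℕ) < k
  · rw [incl_mul_apply_of_lt _ _ ha]
    by_cases hab : (⟨a, ha⟩ : Fin k) ≤ b
    · simp [up, hab]
    · have : (b : ℕ) < a := by simpa [Fin.le_def] using hab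
      simp [up, hab, hM a b this]
  · rw [incl_mul_apply_of_le _ _ (not_lt.mp ha), hM a b (by have := b.2; omega)]

theorem low_transpose_mul_incl_apply (hkd : k ≤ d) (M : Matrix (Fin d) (Fin k) ℝ) (a b : Fin k) :
    ((low M).transpose * incl d k) a b = if (a : ℕ) < b then M (Fin.castLE hkd b) a else 0 := by
  rw [mul_incl_apply hkd]
  simp [low]

/-- With `U = [low M, 0] - [low M, 0]ᵀ`, the first `k` columns of `U`. -/
theorem controller_mul_incl (hkd : k ≤ d) (M : Matrix (Fin d) (Fin k) ℝ) :
    (low M * (incl d k).transpose - (low M * (incl d k).transpose).transpose) * incl d k =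
      low M - incl d k * ((low M).transpose * incl d k) := by
  rw [Matrix.sub_mul, Matrix.mul_assoc, incl_transpose_mul_incl hkd, Matrix.mul_one,
    Matrix.transpose_mul, Matrix.transpose_transpose, Matrix.mul_assoc]

theorem sub_controller_lower (hkd : k ≤ d) (M : Matrix (Fin d) (Fin k) ℝ) (a : Fin d) (b : Fin k)
    (hab : (b : ℕ) < a) :
    (M - (low M - incl d k * ((low M).transpose * incl d k))) a b = 0 := by
  have h1 : (incl d k * ((low M).transpose * incl d k)) a b = 0 := by
    by_cases ha : (a : ℕ) < k
    · rw [incl_mul_apply_of_lt _ _ ha, low_transpose_mul_incl_apply hkd]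
      simp [hab.le]
    · exact incl_mul_apply_of_le _ _ (not_lt.mp ha)
  rw [Matrix.sub_apply, Matrix.sub_apply, h1]
  simp [low, hab]

theorem controller_skew (M : Matrix (Fin d) (Fin k) ℝ) :
    (low M * (incl d k).transpose - (low M * (incl d k).transpose).transpose).transpose =
      -(low M * (incl d k).transpose - (low M * (incl d k).transpose).transpose) := by
  rw [Matrix.transpose_sub, Matrix.transpose_transpose, neg_sub]

end Algebra

section Vfield

variable {n d k : ℕ} {G : Digraph (Fin n)} {w : Fin n → Fin n → ℝ}
  {Q : Fin n → Matrix (Fin d) (Fin d) ℝ} {R : Fin n → Matrix (Fin k) (Fin k) ℝ}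

theorem mix_gen (X : Fin n → Matrix (Fin d) (Fin k) ℝ) (i : Fin n) :
    mix (gen G w) X i =
      open Classical in ∑ j ∈ Finset.univ.filter (fun j => G.Adj i j), w i j • (X j - X i) := by
  classical
  have h : mix (gen G w) X i = (∑ j, (if G.Adj i j then w i j else 0) • X j) -
      (∑ j, if G.Adj i j then w i j else 0) • X i := by
    simp only [mix, gen, Matrix.sub_apply, Matrix.of_apply, sub_smul, Finset.sum_sub_distrib]
    rw [Finset.sum_eq_single_of_mem (f := fun j => Matrix.diagonal _ i j • X j) i
      (Finset.mem_univ i) fun j _ hj => by rw [Matrix.diagonal_apply_ne' _ hj, zero_smul],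
      Matrix.diagonal_apply_eq]
  rw [h, Finset.sum_smul, ← Finset.sum_sub_distrib, Finset.sum_filter]
  refine Finset.sum_congr rfl fun j _ => ?_
  split_ifs
  · rw [smul_sub]
  · rw [zero_smul, zero_smul, sub_zero]

theorem V_eq (i : Fin n) (hQ : (Q i).transpose * Q i = 1) (hR : (R i).det ≠ 0) :
    V G w Q R i =
      (Q i).transpose * mix (gen G w) (fun j => Q j * incl d k * R j) i * (R i)⁻¹ := by
  rw [mix_gen, Matrix.mul_sum, Matrix.sum_mul, V]
  refine Finset.sum_congr rfl fun j _ => ?_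
  have h1 : (Q i).transpose * (Q i * incl d k * R i) * (R i)⁻¹ = incl d k := by
    rw [Matrix.mul_assoc, Matrix.mul_assoc, Matrix.mul_assoc, Matrix.mul_nonsing_inv _ hR.isUnit,
      Matrix.mul_one, ← Matrix.mul_assoc, hQ, Matrix.one_mul]
  rw [Matrix.mul_smul, Matrix.smul_mul, Matrix.mul_sub, Matrix.sub_mul, h1]
  simp only [Matrix.mul_assoc]

end Vfield

section Calculus

variable {l m p : ℕ}

theorem hasDerivWithinAt_mul_entry {M : ℝ → Matrix (Fin l) (Fin m) ℝ}
    {N : ℝ → Matrix (Fin m) (Fin p) ℝ} {M' : Matrix (Fin l) (Fin m) ℝ}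
    {N' : Matrix (Fin m) (Fin p) ℝ} {S : Set ℝ} {t : ℝ}
    (hM : ∀ a b, HasDerivWithinAt (fun s => M s a b) (M' a b) S t)
    (hN : ∀ a b, HasDerivWithinAt (fun s => N s a b) (N' a b) S t) (a : Fin l) (b : Fin p) :
    HasDerivWithinAt (fun s => (M s * N s) a b) ((M' * N t + M t * N') a b) S t := by
  simp only [Matrix.mul_apply, Matrix.add_apply, ← Finset.sum_add_distrib]
  exact HasDerivWithinAt.fun_sum fun c _ => (hM a c).mul (hN c b)

theorem hasDerivWithinAt_mul_const_entry {M : ℝ → Matrix (Fin l) (Fin m) ℝ}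
    {M' : Matrix (Fin l) (Fin m) ℝ} {S : Set ℝ} {t : ℝ} (N : Matrix (Fin m) (Fin p) ℝ)
    (hM : ∀ a b, HasDerivWithinAt (fun s => M s a b) (M' a b) S t) (a : Fin l) (b : Fin p) :
    HasDerivWithinAt (fun s => (M s * N) a b) ((M' * N) a b) S t := by
  simp only [Matrix.mul_apply]
  exact HasDerivWithinAt.fun_sum fun c _ => (hM a c).mul_const _

theorem eq_initial_of_deriv_zero {f : ℝ → ℝ}
    (hf : ∀ t, 0 ≤ t → HasDerivWithinAt f 0 (Ici 0) t) {t : ℝ} (ht : 0 ≤ t) : f t = f 0 :=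
  constant_of_has_deriv_right_zero (a := 0) (b := t)
    (fun s hs => (hf s hs.1).continuousWithinAt.mono Icc_subset_Ici_self)
    (fun s hs => (hf s hs.1).mono (Ici_subset_Ici.mpr hs.1)) t ⟨ht, le_rfl⟩

theorem pos_of_ne_zero_of_continuousOn {f : ℝ → ℝ} (hf : ContinuousOn f (Ici 0))
    (hne : ∀ t, 0 ≤ t → f t ≠ 0) (h0 : 0 < f 0) {t : ℝ} (ht : 0 ≤ t) : 0 < f t := by
  by_contra! h
  obtain ⟨s, hs, hs0⟩ := isPreconnected_Ici.intermediate_value (mem_Ici.mpr ht)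
    (mem_Ici.mpr (le_refl (0 : ℝ))) hf ⟨h, h0.le⟩
  exact hne s hs hs0

/-- The flow `Q' = Q U` with a skew-symmetric `U` preserves the special orthogonal group. -/
theorem specialOrthogonal_of_deriv {Q U : ℝ → Matrix (Fin m) (Fin m) ℝ}
    (hU : ∀ t, 0 ≤ t → (U t).transpose = -U t)
    (hQ : ∀ t, 0 ≤ t → ∀ a b, HasDerivWithinAt (fun s => Q s a b) ((Q t * U t) a b) (Ici 0) t)
    (h0 : Q 0 ∈ Matrix.specialOrthogonalGroup (Fin m) ℝ) {t : ℝ} (ht : 0 ≤ t) :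
    Q t ∈ Matrix.specialOrthogonalGroup (Fin m) ℝ := by
  have horth : ∀ s, 0 ≤ s → (Q s).transpose * Q s = 1 := fun s hs => by
    have h0' := (mem_specialOrthogonal_iff.mp h0).1
    rw [mul_eq_one_comm] at h0' ⊢
    rw [← h0']
    ext a b
    refine eq_initial_of_deriv_zero (f := fun s => (Q s * (Q s).transpose) a b)
      (fun r hr => ?_) hs
    have h := hasDerivWithinAt_mul_entry (N := fun s => (Q s).transpose)
      (N' := (Q r * U r).transpose) (hQ r hr) (fun a b => hQ r hr b a) a b
    rwa [Matrix.transpose_mul, hU r hr, Matrix.neg_mul, Matrix.mul_neg, Matrix.mul_assoc,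
      add_neg_cancel] at h
  have hdet : ∀ s, 0 ≤ s → (Q s).det * (Q s).det = 1 := fun s hs => by
    have h := congrArg Matrix.det (horth s hs)
    rwa [Matrix.det_mul, Matrix.det_transpose, Matrix.det_one] at h
  have hcont : ContinuousOn Q (Ici 0) :=
    continuousOn_pi.mpr fun a => continuousOn_pi.mpr fun b => fun s hs =>
      (hQ s hs a b).continuousWithinAt
  have hpos : 0 < (Q t).det := pos_of_ne_zero_of_continuousOn (f := fun s => (Q s).det)
    (Continuous.comp_continuousOn (Continuous.matrix_det continuous_id) hcont)
    (fun s hs h => by simpa [h] using hdet s hs)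
    (by rw [(mem_specialOrthogonal_iff.mp h0).2]; exact one_pos) ht
  refine mem_specialOrthogonal_iff.mpr ⟨horth t ht, ?_⟩
  nlinarith [hdet t ht]

end Calculus

section Trajectory

variable {n d k : ℕ} {hkd : k ≤ d} {G : Digraph (Fin n)} {w : Fin n → Fin n → ℝ}
  {Q : ℝ → Fin n → Matrix (Fin d) (Fin d) ℝ} {R : ℝ → Fin n → Matrix (Fin k) (Fin k) ℝ}

theorem IsTrajectory.mem_specialOrthogonal (h : IsTrajectory hkd G w Q R)
    (h0 : ∀ i, Q 0 i ∈ Matrix.specialOrthogonalGroup (Fin d) ℝ) {t : ℝ} (ht : 0 ≤ t) (i : Fin n) :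
    Q t i ∈ Matrix.specialOrthogonalGroup (Fin d) ℝ :=
  specialOrthogonal_of_deriv (Q := fun t => Q t i) (U := fun t => U G w (Q t) (R t) i)
    (fun _ _ => controller_skew _) (fun t ht a b => h.deriv_Q t ht i a b) (h0 i) ht

theorem IsTrajectory.mem_RPlus (h : IsTrajectory hkd G w Q R)
    (h0 : ∀ i, R 0 i ∈ RPlus k) {t : ℝ} (ht : 0 ≤ t) (i : Fin n) : R t i ∈ RPlus k := by
  have hlow : ∀ s, 0 ≤ s → ∀ a b, b < a → R s i a b = 0 := fun s hs a b hab => by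
    rw [← (h0 i).1 a b hab]
    refine eq_initial_of_deriv_zero (f := fun s => R s i a b) (fun r hr => ?_) hs
    have := h.deriv_R r hr i a b
    rwa [show rhsR hkd G w (Q r) (R r) i a b = 0 by simp [rhsR, up, hab]] at this
  refine ⟨hlow t ht, fun a => ?_⟩
  refine pos_of_ne_zero_of_continuousOn (f := fun s => R s i a a)
    (fun s hs => (h.deriv_R s hs i a a).continuousWithinAt) (fun s hs h0 => ?_) ((h0 i).2 a) ht
  refine h.det_ne_zero s hs i ?_
  rw [Matrix.det_of_isUpperTriangular (fun a b hab => hlow s hs a b hab)]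
  exact Finset.prod_eq_zero (Finset.mem_univ a) h0

/-- As `V_i - U_i [I_k, 0]ᵀ` and `R_i` are upper triangular, the part of the controller that turns
the columns cancels, and `Q_i [I_k, 0]ᵀ R_i` obeys the consensus equation. -/
theorem IsTrajectory.deriv_state (h : IsTrajectory hkd G w Q R)
    (hQ0 : ∀ i, Q 0 i ∈ Matrix.specialOrthogonalGroup (Fin d) ℝ) (hR0 : ∀ i, R 0 i ∈ RPlus k)
    {t : ℝ} (ht : 0 ≤ t) (i : Fin n) (a : Fin d) (b : Fin k) :
    HasDerivWithinAt (fun s => (Q s i * incl d k * R s i) a b)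
      (mix (gen G w) (fun j => Q t j * incl d k * R t j) i a b) (Ici 0) t := by
  have hd := hasDerivWithinAt_mul_entry
    (hasDerivWithinAt_mul_const_entry (incl d k) (h.deriv_Q t ht i)) (h.deriv_R t ht i) a b
  have hQt := (mem_specialOrthogonal_iff.mp (h.mem_specialOrthogonal hQ0 ht i)).1
  have hRt := h.mem_RPlus hR0 ht i
  set W := V G w (Q t) (R t) i - U G w (Q t) (R t) i * incl d k with hW
  have hWlow : ∀ (a : Fin d) (b : Fin k), (b : ℕ) < a → W a b = 0 := fun a b hab => by
    rw [hW, U, controller_mul_incl hkd]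
    exact sub_controller_lower hkd _ a b hab
  have hWR : incl d k * rhsR hkd G w (Q t) (R t) i = W * R t i := by
    change incl d k * up hkd (W * R t i) = W * R t i
    refine incl_mul_up hkd fun a b hab => ?_
    rw [Matrix.mul_apply]
    refine Finset.sum_eq_zero fun c _ => ?_
    rcases lt_or_ge (c : ℕ) a with hc | hc
    · rw [hWlow a c hc, zero_mul]
    · rw [hRt.1 c b (Fin.lt_def.mpr (hab.trans_le hc)), mul_zero]
  have hQQ : Q t i * (Q t i).transpose = 1 := mul_eq_one_comm.mp hQt
  have hRR : (R t i)⁻¹ * R t i = 1 := Matrix.nonsing_inv_mul _ (RPlus.det_pos hRt).ne'.isUnit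
  have hfinal : Q t i * U G w (Q t) (R t) i * incl d k * R t i +
      Q t i * incl d k * rhsR hkd G w (Q t) (R t) i =
      mix (gen G w) (fun j => Q t j * incl d k * R t j) i := by
    rw [Matrix.mul_assoc (Q t i) (incl d k), hWR, hW, V_eq i hQt (RPlus.det_pos hRt).ne']
    rw [Matrix.sub_mul, Matrix.mul_sub]
    simp only [Matrix.mul_assoc]
    rw [hRR, Matrix.mul_one, add_sub_cancel, ← Matrix.mul_assoc, hQQ, Matrix.one_mul]
  rwa [hfinal] at hd

theorem IsTrajectory.state_eq (h : IsTrajectory hkd G w Q R)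
    (hQ0 : ∀ i, Q 0 i ∈ Matrix.specialOrthogonalGroup (Fin d) ℝ) (hR0 : ∀ i, R 0 i ∈ RPlus k)
    {t : ℝ} (ht : 0 ≤ t) (i : Fin n) :
    Q t i * incl d k * R t i =
      mix (exp (t • gen G w)) (fun j => Q 0 j * incl d k * R 0 j) i := by
  ext a b
  have key := matrixODE_unique (l := 1) (Ω := fun _ => gen G w) continuousOn_const
    (Z := fun s => Matrix.of fun i _ => (Q s i * incl d k * R s i) a b)
    (Z' := fun s => exp (s • gen G w) * Matrix.of fun i _ => (Q 0 i * incl d k * R 0 i) a b)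
    (fun s hs i c => by
      have := h.deriv_state hQ0 hR0 hs i a b
      rw [mix_apply] at this
      simpa [Matrix.mul_apply] using this)
    (fun s hs i c => by
      have := hasDerivWithinAt_mul_const_entry (S := Ici 0)
        (Matrix.of fun i (_ : Fin 1) => (Q 0 i * incl d k * R 0 i) a b)
        (fun i j => (hasDerivAt_exp_entry (gen G w) s i j).hasDerivWithinAt) i c
      rwa [Matrix.mul_assoc] at this)
    (by simp) ht
  have := congrFun (congrFun key i) 0
  rw [mix_apply]
  simpa [Matrix.mul_apply] using this

end Trajectory

end

/-! ### Existence of the closed-loop solution along a consensus solution of full rank -/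

section

open Set
open NormedSpace (exp)

/-- The controller matrix `[low M, 0] - [low M, 0]ᵀ`. -/
def ctrl {d k : ℕ} (M : Matrix (Fin d) (Fin k) ℝ) : Matrix (Fin d) (Fin d) ℝ :=
  low M * (incl d k).transpose - (low M * (incl d k).transpose).transpose

section Frame

variable {d k : ℕ}

theorem low_add_incl_mul {M : Matrix (Fin d) (Fin k) ℝ} {S : Matrix (Fin k) (Fin k) ℝ}
    (hS : S.BlockTriangular id) : low (M + incl d k * S) = low M := by
  ext a b
  by_cases hab : (b : ℕ) < a
  · have h0 : (incl d k * S) a b = 0 := by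
      by_cases ha : (a : ℕ) < k
      · rw [incl_mul_apply_of_lt _ _ ha]
        exact hS (Fin.lt_def.mpr hab)
      · exact incl_mul_apply_of_le _ _ (not_lt.mp ha)
    simp only [low, Matrix.of_apply, hab, if_true]
    rw [Matrix.add_apply, h0, add_zero]
  · simp [low, hab]

theorem low_eq_sub_incl_mul_up (hkd : k ≤ d) (M : Matrix (Fin d) (Fin k) ℝ) :
    low M = M - incl d k * up le_rfl ((incl d k).transpose * M) := by
  have hrow : ∀ (a b : Fin k), ((incl d k).transpose * M) a b = M (Fin.castLE hkd a) b :=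
    fun a b => by
      have := mul_incl_apply hkd M.transpose b a
      rw [← Matrix.transpose_apply ((incl d k).transpose * M), Matrix.transpose_mul,
        Matrix.transpose_transpose, this, Matrix.transpose_apply]
  ext a b
  rw [Matrix.sub_apply]
  by_cases ha : (a : ℕ) < k
  · rw [incl_mul_apply_of_lt _ _ ha]
    by_cases hab : (b : ℕ) < a
    · have : ¬ (⟨a, ha⟩ : Fin k) ≤ b := by simpa [Fin.le_def] using hab
      simp [low, up, hab, this]
    · have : (⟨a, ha⟩ : Fin k) ≤ b := by simpa [Fin.le_def] using hab
      simp [low, up, hab, this, hrow]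
  · have hab : (b : ℕ) < a := by have := b.2; omega
    rw [incl_mul_apply_of_le _ _ (not_lt.mp ha)]
    simp [low, hab]

theorem up_sub_transpose_of_skew {K : Matrix (Fin k) (Fin k) ℝ} (hK : K.transpose = -K) :
    up le_rfl K - (up le_rfl K).transpose = K := by
  have h : ∀ a b, K b a = -K a b := fun a b => congrFun (congrFun hK a) b
  ext a b
  rcases lt_trichotomy a b with hab | hab | hab
  · simp [up, hab.le, hab]
  · subst hab
    have := h a a
    simp [up]
    linarith
  · simp [up, hab.le, hab, h b a]

theorem continuous_up : Continuous fun K : Matrix (Fin k) (Fin k) ℝ => up le_rfl K := by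
  refine continuous_matrix fun a b => ?_
  by_cases hab : a ≤ b
  · simp only [up, Matrix.of_apply, hab, if_true]
    exact continuous_id.matrix_elem _ _
  · simp only [up, Matrix.of_apply, hab, if_false]
    exact continuous_const

theorem transpose_mem_specialOrthogonal {P : Matrix (Fin d) (Fin d) ℝ}
    (hP : P ∈ Matrix.specialOrthogonalGroup (Fin d) ℝ) :
    P.transpose ∈ Matrix.specialOrthogonalGroup (Fin d) ℝ := by
  rw [mem_specialOrthogonal_iff] at hP ⊢
  rw [Matrix.transpose_transpose, Matrix.det_transpose]
  exact ⟨mul_eq_one_comm.mp hP.1, hP.2⟩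

/-- A continuously differentiable orthonormal `k`-frame `C` lifts to a curve of rotations that is
driven by the controller of `QᵀC'`. The controller determines the lift through the linear equation
`Q' = (Z Cᵀ - C Zᵀ) Q` with `Z = C' - C up(CᵀC')`, whose coefficients depend on `C` alone. -/
theorem exists_rotation_lift (hkd : k ≤ d) {C C' : ℝ → Matrix (Fin d) (Fin k) ℝ}
    (hC' : ContinuousOn C' (Ici 0))
    (hd : ∀ t, 0 ≤ t → ∀ a b, HasDerivWithinAt (fun s => C s a b) (C' t a b) (Ici 0) t)
    (horth : ∀ t, 0 ≤ t → (C t).transpose * C t = 1) {P : Matrix (Fin d) (Fin d) ℝ}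
    (hP : P ∈ Matrix.specialOrthogonalGroup (Fin d) ℝ) (hPC : P * incl d k = C 0) :
    ∃ Q : ℝ → Matrix (Fin d) (Fin d) ℝ, Q 0 = P ∧ ∀ t, 0 ≤ t →
      Q t ∈ Matrix.specialOrthogonalGroup (Fin d) ℝ ∧ Q t * incl d k = C t ∧
      (∀ a b, HasDerivWithinAt (fun s => Q s a b)
        ((Q t * ctrl ((Q t).transpose * C' t)) a b) (Ici 0) t) ∧
      ctrl ((Q t).transpose * C' t) * incl d k = (Q t).transpose * C' t := by
  have hCc : ContinuousOn C (Ici 0) := continuousOn_pi.mpr fun a => continuousOn_pi.mpr fun b =>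
    fun s hs => (hd s hs a b).continuousWithinAt
  have hskew : ∀ t, 0 ≤ t → ((C t).transpose * C' t).transpose = -((C t).transpose * C' t) := by
    intro t ht
    rw [Matrix.transpose_mul, Matrix.transpose_transpose, eq_neg_iff_add_eq_zero]
    ext a b
    have h1 := hasDerivWithinAt_mul_entry (M := fun s => (C s).transpose)
      (M' := (C' t).transpose) (fun a b => hd t ht b a) (hd t ht) a b
    have h2 : HasDerivWithinAt (fun s => ((C s).transpose * C s) a b) 0 (Ici 0) t :=
      (hasDerivWithinAt_const t (Ici 0) ((1 : Matrix (Fin k) (Fin k) ℝ) a b)).congr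
        (fun s hs => by rw [horth s hs]) (by rw [horth t ht])
    exact (uniqueDiffOn_Ici 0 t ht).eq_deriv _ h1 h2
  set Z : ℝ → Matrix (Fin d) (Fin k) ℝ :=
    fun t => C' t - C t * up le_rfl ((C t).transpose * C' t) with hZ
  set Ω : ℝ → Matrix (Fin d) (Fin d) ℝ :=
    fun t => Z t * (C t).transpose - C t * (Z t).transpose with hΩ
  have htr : ∀ {M : ℝ → Matrix (Fin d) (Fin k) ℝ}, ContinuousOn M (Ici 0) →
      ContinuousOn (fun t => (M t).transpose) (Ici 0) := fun hM =>
    (show Continuous fun A : Matrix (Fin d) (Fin k) ℝ => A.transpose from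
      Continuous.matrix_transpose continuous_id).comp_continuousOn hM
  have hCt := htr hCc
  have hmul : ∀ {l m p : ℕ} {M : ℝ → Matrix (Fin l) (Fin m) ℝ} {N : ℝ → Matrix (Fin m) (Fin p) ℝ},
      ContinuousOn M (Ici 0) → ContinuousOn N (Ici 0) →
      ContinuousOn (fun t => M t * N t) (Ici 0) := fun hM hN =>
    Continuous.comp_continuousOn (Continuous.matrix_mul continuous_fst continuous_snd)
      (hM.prodMk hN)
  have hZc : ContinuousOn Z (Ici 0) :=
    hC'.sub (hmul hCc (continuous_up.comp_continuousOn (hmul hCt hC')))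
  have hΩc : ContinuousOn Ω (Ici 0) := (hmul hZc hCt).sub (hmul hCc (htr hZc))
  have hΩskew : ∀ t, (-Ω t).transpose = -(-Ω t) := fun t => by
    simp [hΩ, Matrix.transpose_sub, Matrix.transpose_mul]
  have hΩC : ∀ t, 0 ≤ t → Ω t * C t = C' t := fun t ht => by
    have h1 : (Z t).transpose * C t = -((C t).transpose * C' t) -
        (up le_rfl ((C t).transpose * C' t)).transpose := by
      have h2 := hskew t ht
      rw [Matrix.transpose_mul, Matrix.transpose_transpose] at h2
      rw [hZ, Matrix.transpose_sub, Matrix.sub_mul, h2, Matrix.transpose_mul, Matrix.mul_assoc,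
        horth t ht, Matrix.mul_one]
    have h3 := up_sub_transpose_of_skew (hskew t ht)
    rw [hΩ, Matrix.sub_mul, Matrix.mul_assoc, horth t ht, Matrix.mul_one, Matrix.mul_assoc, h1]
    have h4 : -((C t).transpose * C' t) - (up le_rfl ((C t).transpose * C' t)).transpose =
        -up le_rfl ((C t).transpose * C' t) := by
      nth_rw 1 [← h3]
      abel
    rw [h4, Matrix.mul_neg, sub_neg_eq_add]
    exact sub_add_cancel _ _
  obtain ⟨Q, hQ0, hQ⟩ := matrixODE_exists hΩc P
  refine ⟨Q, hQ0, fun t ht => ?_⟩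
  have hSO : Q t ∈ Matrix.specialOrthogonalGroup (Fin d) ℝ := by
    have := specialOrthogonal_of_deriv (Q := fun s => (Q s).transpose) (U := fun s => -Ω s)
      (fun s _ => hΩskew s)
      (fun s hs a b => by
        have h1 := hQ s hs b a
        rwa [← Matrix.transpose_apply (Ω s * Q s), Matrix.transpose_mul,
          show (Ω s).transpose = -Ω s by
            have := hΩskew s
            rwa [Matrix.transpose_neg, neg_inj] at this] at h1)
      (by rw [hQ0]; exact transpose_mem_specialOrthogonal hP) ht
    simpa using transpose_mem_specialOrthogonal this
  have hQQ := (mem_specialOrthogonal_iff.mp hSO).1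
  have hQQ' := mul_eq_one_comm.mp hQQ
  have hQC : Q t * incl d k = C t :=
    matrixODE_unique (Z := fun s => Q s * incl d k) hΩc
      (fun s hs a b => by
        rw [← Matrix.mul_assoc]
        exact hasDerivWithinAt_mul_const_entry (incl d k) (hQ s hs) a b)
      (fun s hs a b => by rw [hΩC s hs]; exact hd s hs a b) (by rw [hQ0, hPC]) ht
  have hlowZ : Q t * low ((Q t).transpose * C' t) = Z t := by
    rw [low_eq_sub_incl_mul_up hkd, Matrix.mul_sub, ← Matrix.mul_assoc, hQQ', Matrix.one_mul,
      ← Matrix.mul_assoc, hQC, ← Matrix.mul_assoc, ← Matrix.transpose_mul, hQC]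
  have hΩQ : Q t * ctrl ((Q t).transpose * C' t) = Ω t * Q t := by
    have h1 : (C t).transpose * Q t = (incl d k).transpose := by
      rw [← hQC, Matrix.transpose_mul, Matrix.mul_assoc, hQQ, Matrix.mul_one]
    have h2 : (Z t).transpose * Q t = (low ((Q t).transpose * C' t)).transpose := by
      rw [← hlowZ, Matrix.transpose_mul, Matrix.mul_assoc, hQQ, Matrix.mul_one]
    rw [hΩ, Matrix.sub_mul, Matrix.mul_assoc, h1, Matrix.mul_assoc, h2, ctrl, Matrix.mul_sub,
      Matrix.transpose_mul, Matrix.transpose_transpose, ← Matrix.mul_assoc, hlowZ,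
      ← Matrix.mul_assoc, hQC]
  refine ⟨hSO, hQC, fun a b => ?_, ?_⟩
  · rw [hΩQ]
    exact hQ t ht a b
  · have h1 : Q t * (ctrl ((Q t).transpose * C' t) * incl d k) = C' t := by
      rw [← Matrix.mul_assoc, hΩQ, Matrix.mul_assoc, hQC, hΩC t ht]
    rw [← Matrix.one_mul (ctrl _ * _), ← hQQ, Matrix.mul_assoc, h1]

end Frame

section Existence

variable {n d k : ℕ}

section

open scoped Matrix.Norms.Operator

theorem contDiff_exp_entry (H : Matrix (Fin n) (Fin n) ℝ) (i j : Fin n) :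
    ContDiff ℝ 2 fun s : ℝ => exp (s • H) i j := by
  have h1 : ContDiff ℝ 2 fun s : ℝ => exp (s • H) :=
    contDiff_iff_contDiffAt.mpr fun s =>
      (NormedSpace.exp_analytic (𝕂 := ℝ) (s • H)).contDiffAt.comp s
        (contDiff_id.smul contDiff_const).contDiffAt
  exact (LinearMap.toContinuousLinearMap (Matrix.entryLinearMap ℝ ℝ i j)).contDiff.comp h1

end

theorem contDiff_mix_exp (H : Matrix (Fin n) (Fin n) ℝ) (X : Fin n → Matrix (Fin d) (Fin k) ℝ)
    (i : Fin n) : ContDiff ℝ 2 fun (s : ℝ) (a : Fin d) (b : Fin k) => mix (exp (s • H)) X i a b := by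
  refine contDiff_pi.mpr fun a => contDiff_pi.mpr fun b => ?_
  simp only [mix_apply]
  exact ContDiff.sum fun j _ => (contDiff_exp_entry H i j).mul contDiff_const

theorem hasDerivWithinAt_mix_exp (H : Matrix (Fin n) (Fin n) ℝ)
    (X : Fin n → Matrix (Fin d) (Fin k) ℝ) (i : Fin n) (a : Fin d) (b : Fin k) (S : Set ℝ) (t : ℝ) :
    HasDerivWithinAt (fun s : ℝ => mix (exp (s • H)) X i a b)
      (mix H (mix (exp (t • H)) X) i a b) S t := by
  rw [← mix_mul]
  simp only [mix_apply]
  exact HasDerivWithinAt.fun_sum fun j _ =>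
    (hasDerivAt_exp_entry H t i j).hasDerivWithinAt.mul_const _

theorem continuousAt_deriv_of_contDiffAt {f : ℝ → ℝ} {t : ℝ} (hf : ContDiffAt ℝ 2 f t) :
    ContinuousAt (deriv f) t := by
  have h1 : ContDiffAt ℝ 1 (fderiv ℝ f) t := hf.fderiv_right (by norm_num)
  exact h1.continuousAt.clm_apply continuousAt_const

/-- If the solution of the consensus equation through `[Q_i(0) [I_k, 0]ᵀ R_i(0)]` keeps full column
rank, its QR decomposition lifts to a solution of the closed loop. -/
theorem exists_trajectory (hkd : k ≤ d) (G : Digraph (Fin n)) (w : Fin n → Fin n → ℝ)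
    {P : Fin n → Matrix (Fin d) (Fin d) ℝ}
    (hP : ∀ i, P i ∈ Matrix.specialOrthogonalGroup (Fin d) ℝ)
    {R₀ : Fin n → Matrix (Fin k) (Fin k) ℝ} (hR₀ : ∀ i, R₀ i ∈ RPlus k)
    (hfull : ∀ t : ℝ, 0 ≤ t → ∀ i,
      FullRank (mix (exp (t • gen G w)) (fun j => P j * incl d k * R₀ j) i)) :
    ∃ Q R, IsTrajectory hkd G w Q R ∧ StartsAt Q R P R₀ := by
  set X : ℝ → Fin n → Matrix (Fin d) (Fin k) ℝ :=
    fun t => mix (exp (t • gen G w)) (fun j => P j * incl d k * R₀ j) with hX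
  have hX0 : ∀ i, X 0 i = P i * incl d k * R₀ i := fun i => by simp [hX, mix_one]
  have hC0 : ∀ i, qFac (X 0 i) = P i * incl d k ∧ rFac (X 0 i) = R₀ i := fun i => by
    rw [hX0]
    exact qFac_rFac_mul (transpose_mul_self_mul_incl hkd (mem_specialOrthogonal_iff.mp (hP i)).1)
      (hR₀ i)
  have hCD : ∀ t, 0 ≤ t → ∀ i a b, ContDiffAt ℝ 2 (fun s => qFac (X s i) a b) t :=
    fun t ht i a b => ContDiffAt.comp (f := fun (s : ℝ) (a : Fin d) (b : Fin k) => X s i a b) t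
      (contDiffAt_qFac (hfull t ht i) a b) (contDiff_mix_exp _ _ i).contDiffAt
  have hRD : ∀ t, 0 ≤ t → ∀ i a b, ContDiffAt ℝ 2 (fun s => rFac (X s i) a b) t :=
    fun t ht i a b => ContDiffAt.comp (f := fun (s : ℝ) (a : Fin d) (b : Fin k) => X s i a b) t
      (contDiffAt_rFac (hfull t ht i) a b) (contDiff_mix_exp _ _ i).contDiffAt
  set C' : Fin n → ℝ → Matrix (Fin d) (Fin k) ℝ :=
    fun i t => Matrix.of fun a b => deriv (fun s => qFac (X s i) a b) t with hC'
  set R' : Fin n → ℝ → Matrix (Fin k) (Fin k) ℝ :=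
    fun i t => Matrix.of fun a b => deriv (fun s => rFac (X s i) a b) t with hR'
  have hCd : ∀ i t, 0 ≤ t → ∀ a b,
      HasDerivWithinAt (fun s => qFac (X s i) a b) (C' i t a b) (Ici 0) t := fun i t ht a b =>
    ((hCD t ht i a b).differentiableAt (by norm_num)).hasDerivAt.hasDerivWithinAt
  have hRd : ∀ i t, 0 ≤ t → ∀ a b,
      HasDerivWithinAt (fun s => rFac (X s i) a b) (R' i t a b) (Ici 0) t := fun i t ht a b =>
    ((hRD t ht i a b).differentiableAt (by norm_num)).hasDerivAt.hasDerivWithinAt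
  have hC'c : ∀ i, ContinuousOn (C' i) (Ici 0) := fun i =>
    continuousOn_pi.mpr fun a => continuousOn_pi.mpr fun b => fun t ht =>
      (continuousAt_deriv_of_contDiffAt (hCD t ht i a b)).continuousWithinAt
  have hlift := fun i => exists_rotation_lift hkd (hC'c i) (hCd i)
    (fun t ht => (hfull t ht i).qFac_transpose_mul) (hP i) (hC0 i).1.symm
  choose Q hQ0 hQ using hlift
  -- The derivative of `X = C R`.
  have hprod : ∀ i t, 0 ≤ t → mix (gen G w) (X t) i =
      C' i t * rFac (X t i) + qFac (X t i) * R' i t := fun i t ht => by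
    ext a b
    have h1 := hasDerivWithinAt_mul_entry (hCd i t ht) (hRd i t ht) a b
    have h2 := hasDerivWithinAt_mix_exp (gen G w) (fun j => P j * incl d k * R₀ j) i a b (Ici 0) t
    refine (uniqueDiffOn_Ici 0 t ht).eq_deriv _ h2 (h1.congr (fun s hs => ?_) ?_)
    · rw [(hfull s hs i).qFac_mul_rFac]
    · rw [(hfull t ht i).qFac_mul_rFac]
  have hR'tri : ∀ i t, 0 ≤ t → (R' i t).BlockTriangular id := fun i t ht a b hab =>
    (uniqueDiffOn_Ici 0 t ht).eq_deriv _ (hRd i t ht a b)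
      ((hasDerivWithinAt_const t (Ici 0) (0 : ℝ)).congr
        (fun s hs => (hfull s hs i).rFac_mem.1 a b hab) ((hfull t ht i).rFac_mem.1 a b hab))
  refine ⟨fun t i => Q i t, fun t i => rFac (X t i), ?_, ?_⟩
  swap
  · exact ⟨funext hQ0, funext fun i => (hC0 i).2⟩
  have hcontrol : ∀ t, 0 ≤ t → ∀ i,
      V G w (fun i => Q i t) (fun i => rFac (X t i)) i =
        (Q i t).transpose * C' i t + incl d k * (R' i t * (rFac (X t i))⁻¹) ∧
      U G w (fun i => Q i t) (fun i => rFac (X t i)) i = ctrl ((Q i t).transpose * C' i t) := by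
    intro t ht i
    have hmem := (hfull t ht i).rFac_mem
    have hdet := (RPlus.det_pos hmem).ne'
    have hSO := (mem_specialOrthogonal_iff.mp (hQ i t ht).1).1
    have hV : V G w (fun i => Q i t) (fun i => rFac (X t i)) i =
        (Q i t).transpose * C' i t + incl d k * (R' i t * (rFac (X t i))⁻¹) := by
      have hXeq : (fun j => Q j t * incl d k * rFac (X t j)) = X t := funext fun j => by
        rw [(hQ j t ht).2.1, (hfull t ht j).qFac_mul_rFac]
      have hE : (Q i t).transpose * qFac (X t i) = incl d k := by
        rw [← (hQ i t ht).2.1, ← Matrix.mul_assoc, hSO, Matrix.one_mul]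
      rw [V_eq i hSO hdet, hXeq, hprod i t ht, Matrix.mul_add, Matrix.add_mul, ← Matrix.mul_assoc,
        Matrix.mul_assoc _ _ (rFac (X t i))⁻¹, Matrix.mul_nonsing_inv _ hdet.isUnit, Matrix.mul_one,
        ← Matrix.mul_assoc, hE, Matrix.mul_assoc]
    refine ⟨hV, ?_⟩
    have : Invertible (rFac (X t i)) := Matrix.invertibleOfIsUnitDet _ hdet.isUnit
    rw [U, hV, low_add_incl_mul, ctrl]
    exact (hR'tri i t ht).mul
      (Matrix.blockTriangular_inv_of_blockTriangular (RPlus.blockTriangular hmem))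
  refine ⟨fun t ht i => (RPlus.det_pos (hfull t ht i).rFac_mem).ne', fun t ht i a b => ?_,
    fun t ht i a b => ?_⟩
  · rw [(hcontrol t ht i).2]
    exact (hQ i t ht).2.2.1 a b
  · have hdet := (RPlus.det_pos (hfull t ht i).rFac_mem).ne'
    have hrhs : rhsR hkd G w (fun i => Q i t) (fun i => rFac (X t i)) i = R' i t := by
      rw [rhsR, (hcontrol t ht i).1, (hcontrol t ht i).2, (hQ i t ht).2.2.2, add_sub_cancel_left,
        Matrix.mul_assoc, Matrix.mul_assoc, Matrix.nonsing_inv_mul _ hdet.isUnit, Matrix.mul_one]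
      ext a b
      by_cases hab : a ≤ b
      · simp only [up, Matrix.of_apply, hab, if_true]
        exact incl_mul_apply_of_lt _ _ a.2
      · simp only [up, Matrix.of_apply, hab, if_false]
        exact (hR'tri i t ht (not_le.mp hab)).symm
    rw [hrhs]
    exact hRd i t ht a b

end Existence

end

/-! ### The good initial conditions in terms of the consensus flow -/

section

open Set
open NormedSpace (exp)

/-- The propagators `exp (t H)` for `t ≥ 0`, together with their limit, the matrix all of whose rows
are `p`. -/
def propagators {n : ℕ} (H : Matrix (Fin n) (Fin n) ℝ) (p : Fin n → ℝ) :
    Set (Matrix (Fin n) (Fin n) ℝ) :=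
  insert (Matrix.of fun _ j => p j) (range fun t : ℝ => exp (‖t‖ • H))

/-- All matrices in `K` send the tuple `X` to tuples of matrices of full column rank. -/
def KeepsFullRank {n d k : ℕ} (K : Set (Matrix (Fin n) (Fin n) ℝ))
    (X : Fin n → Matrix (Fin d) (Fin k) ℝ) : Prop := ∀ A ∈ K, ∀ i, FullRank (mix A X i)

/-- The products `Q_i(0,k) R_i(0)`. -/
def product {n d k : ℕ} (p : State n d k) (i : Fin n) : Matrix (Fin d) (Fin k) ℝ := p.1 i * p.2 i

/-- The QR decomposition of each member of a tuple. -/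
def factors {n d k : ℕ} (X : Fin n → Matrix (Fin d) (Fin k) ℝ) : State n d k :=
  (fun i => qFac (X i), fun i => rFac (X i))

section Characterization

variable {n d k : ℕ} {G : Digraph (Fin n)} {w : Fin n → Fin n → ℝ} {p : Fin n → ℝ}
  {H : Matrix (Fin n) (Fin n) ℝ}

theorem tendsto_mix_exp
    (hp : ∀ i j, Tendsto (fun t : ℝ => exp (t • H) i j) atTop (𝓝 (p j)))
    (X : Fin n → Matrix (Fin d) (Fin k) ℝ) (i : Fin n) :
    Tendsto (fun t : ℝ => mix (exp (t • H)) X i) atTop (𝓝 (mix (Matrix.of fun _ j => p j) X i)) :=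
  tendsto_finsetSum _ fun j _ => (hp i j).smul_const (X j)

theorem keepsFullRank_propagators_iff {X : Fin n → Matrix (Fin d) (Fin k) ℝ} :
    KeepsFullRank (propagators H p) X ↔
      (∀ i, FullRank (mix (Matrix.of fun _ j => p j) X i)) ∧
        ∀ t : ℝ, 0 ≤ t → ∀ i, FullRank (mix (exp (t • H)) X i) := by
  rw [KeepsFullRank, propagators, forall_mem_insert, forall_mem_range]
  refine and_congr_right fun _ => ⟨fun h t ht i => ?_, fun h t i => h _ (norm_nonneg t) i⟩
  have := h t i
  rwa [Real.norm_of_nonneg ht] at this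

theorem tendsto_matrix_mul {α : Type*} {f : Filter α} {l m q : ℕ}
    {M : α → Matrix (Fin l) (Fin m) ℝ} {N : α → Matrix (Fin m) (Fin q) ℝ}
    {A : Matrix (Fin l) (Fin m) ℝ} {B : Matrix (Fin m) (Fin q) ℝ} (hM : Tendsto M f (𝓝 A))
    (hN : Tendsto N f (𝓝 B)) : Tendsto (fun t => M t * N t) f (𝓝 (A * B)) := by
  refine tendsto_pi_nhds.mpr fun a => tendsto_pi_nhds.mpr fun b => ?_
  simp only [Matrix.mul_apply]
  exact tendsto_finsetSum _ fun c _ => (tendsto_pi_nhds.mp (tendsto_pi_nhds.mp hM a) c).mul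
    (tendsto_pi_nhds.mp (tendsto_pi_nhds.mp hN c) b)

theorem isCompact_propagators
    (hp : ∀ i j, Tendsto (fun t : ℝ => exp (t • H) i j) atTop (𝓝 (p j))) :
    IsCompact (propagators H p) := by
  refine Tendsto.isCompact_insert_range_of_cocompact ?_
    ((continuous_exp_smul H).comp continuous_norm)
  have h : Tendsto (fun t : ℝ => exp (t • H)) atTop (𝓝 (Matrix.of fun _ j => p j)) :=
    tendsto_pi_nhds.mpr fun i => tendsto_pi_nhds.mpr fun j => hp i j
  exact h.comp (tendsto_norm_cocompact_atTop (E := ℝ))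

theorem isOpen_keepsFullRank {K : Set (Matrix (Fin n) (Fin n) ℝ)} (hK : IsCompact K) :
    IsOpen {X : Fin n → Matrix (Fin d) (Fin k) ℝ | KeepsFullRank K X} := by
  rw [isOpen_iff_mem_nhds]
  intro X hX
  refine hK.eventually_forall_of_forall_eventually
    (P := fun X A => ∀ i, FullRank (mix A X i)) fun A hA => ?_
  rw [eventually_all]
  intro i
  have hcont : Continuous fun z : (Fin n → Matrix (Fin d) (Fin k) ℝ) × Matrix (Fin n) (Fin n) ℝ =>
      mix z.2 z.1 i := by
    unfold mix
    exact continuous_finsetSum _ fun j _ => (continuous_snd.matrix_elem i j).smul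
      ((continuous_apply j).comp continuous_fst)
  exact (isOpen_fullRank.preimage hcont).mem_nhds (hX A hA i)

theorem continuousAt_factors {X : Matrix (Fin d) (Fin k) ℝ} (hX : FullRank X) :
    ContinuousAt (qFac : Matrix (Fin d) (Fin k) ℝ → _) X ∧
      ContinuousAt (rFac : Matrix (Fin d) (Fin k) ℝ → _) X :=
  ⟨continuousAt_pi.mpr fun a => continuousAt_pi.mpr fun b => (contDiffAt_qFac hX a b).continuousAt,
    continuousAt_pi.mpr fun a => continuousAt_pi.mpr fun b => (contDiffAt_rFac hX a b).continuousAt⟩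

theorem keepsFullRank_of_mem_DQRFull (hkd : k ≤ d)
    (hp : ∀ i j, Tendsto (fun t : ℝ => exp (t • gen G w) i j) atTop (𝓝 (p j)))
    {x : State n d k} (hx : x ∈ DQRFull hkd G w) :
    KeepsFullRank (propagators (gen G w) p) (product x) := by
  obtain ⟨hxD, h⟩ := hx
  choose P hP hPx using hxD.1
  obtain ⟨⟨Q, R, hT, hQ0, hR0⟩, hsync⟩ := h P fun i => ⟨hP i, (hPx i).symm⟩
  obtain ⟨-, Qbar, hQbar, Rbar, hRbar, hlim⟩ := hsync Q R hT ⟨hQ0, hR0⟩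
  have hSO0 : ∀ i, Q 0 i ∈ Matrix.specialOrthogonalGroup (Fin d) ℝ := fun i => by
    rw [hQ0]; exact hP i
  have hRP0 : ∀ i, R 0 i ∈ RPlus k := fun i => by rw [hR0]; exact hxD.2 i
  have hprod : product x = fun j => Q 0 j * incl d k * R 0 j := by
    funext j
    rw [product, hPx, hQ0, hR0]
  have hstate : ∀ t : ℝ, 0 ≤ t → ∀ i, Q t i * incl d k * R t i =
      mix (exp (t • gen G w)) (product x) i := fun t ht i => by
    rw [hprod]
    exact hT.state_eq hSO0 hRP0 ht i
  rw [keepsFullRank_propagators_iff]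
  refine ⟨fun i => ?_, fun t ht i => ?_⟩
  · have h1 : Tendsto (fun t => Q t i * incl d k * R t i) atTop (𝓝 (Qbar * incl d k * Rbar)) :=
      tendsto_matrix_mul (hlim i).1 (hlim i).2
    have h3 : (fun t => Q t i * incl d k * R t i) =ᶠ[atTop]
        fun t => mix (exp (t • gen G w)) (product x) i := by
      filter_upwards [eventually_ge_atTop 0] with t ht using hstate t ht i
    rw [tendsto_nhds_unique (tendsto_mix_exp hp (product x) i) (h1.congr' h3)]
    exact fullRank_mul
      (transpose_mul_self_mul_incl hkd (mem_specialOrthogonal_iff.mp hQbar).1) hRbar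
  · rw [← hstate t ht i]
    exact fullRank_mul (transpose_mul_self_mul_incl hkd
      (mem_specialOrthogonal_iff.mp (hT.mem_specialOrthogonal hSO0 ht i)).1)
      (hT.det_ne_zero _ ht i)

theorem staysAndSynchronizes_of_keepsFullRank (hkd : k < d)
    (hp : ∀ i j, Tendsto (fun t : ℝ => exp (t • gen G w) i j) atTop (𝓝 (p j)))
    {Q : ℝ → Fin n → Matrix (Fin d) (Fin d) ℝ} {R : ℝ → Fin n → Matrix (Fin k) (Fin k) ℝ}
    (hT : IsTrajectory hkd.le G w Q R)
    (hSO0 : ∀ i, Q 0 i ∈ Matrix.specialOrthogonalGroup (Fin d) ℝ) (hRP0 : ∀ i, R 0 i ∈ RPlus k)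
    (hfull : KeepsFullRank (propagators (gen G w) p) fun j => Q 0 j * incl d k * R 0 j) :
    StaysAndSynchronizes Q R := by
  have hSO := fun (t : ℝ) (ht : 0 ≤ t) i => hT.mem_specialOrthogonal hSO0 ht i
  have hRP := fun (t : ℝ) (ht : 0 ≤ t) i => hT.mem_RPlus hRP0 ht i
  refine ⟨fun t ht => ⟨fun i => ⟨Q t i, hSO t ht i, rfl⟩, fun i => hRP t ht i⟩, ?_⟩
  rcases isEmpty_or_nonempty (Fin n) with hempty | ⟨⟨i₀⟩⟩
  · exact ⟨1, one_mem _, 1, by simp, fun i => hempty.elim i⟩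
  have hlim : ∀ i, Tendsto (fun t => Q t i * incl d k * R t i) atTop
      (𝓝 (mix (Matrix.of fun _ j => p j) (fun j => Q 0 j * incl d k * R 0 j) i₀)) := fun i => by
    refine (tendsto_mix_exp hp (fun j => Q 0 j * incl d k * R 0 j) i).congr' ?_
    filter_upwards [eventually_ge_atTop 0] with t ht using (hT.state_eq hSO0 hRP0 ht i).symm
  have hfullbar := (keepsFullRank_propagators_iff.mp hfull).1 i₀
  set Xbar := mix (Matrix.of fun _ j => p j) (fun j => Q 0 j * incl d k * R 0 j) i₀
  obtain ⟨Qbar, hQbar, hQC⟩ := exists_specialOrthogonal_mul_incl hkd hfullbar.qFac_transpose_mul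
  refine ⟨Qbar, hQbar, rFac Xbar, (RPlus.det_pos hfullbar.rFac_mem).ne', fun i => ?_⟩
  have hfac : ∀ t, 0 ≤ t → qFac (Q t i * incl d k * R t i) = Q t i * incl d k ∧
      rFac (Q t i * incl d k * R t i) = R t i := fun t ht =>
    qFac_rFac_mul (transpose_mul_self_mul_incl hkd.le
      (mem_specialOrthogonal_iff.mp (hSO t ht i)).1) (hRP t ht i)
  obtain ⟨hq, hr⟩ := continuousAt_factors hfullbar
  rw [hQC]
  constructor
  · refine (hq.tendsto.comp (hlim i)).congr' ?_
    filter_upwards [eventually_ge_atTop 0] with t ht using (hfac t ht).1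
  · refine (hr.tendsto.comp (hlim i)).congr' ?_
    filter_upwards [eventually_ge_atTop 0] with t ht using (hfac t ht).2

/-- The set `D_QR,full(k)` is the preimage under `[Q, R] ↦ (Q_i R_i)_i` of the tuples that keep full
rank under the consensus flow and in the limit. -/
theorem mem_DQRFull_iff (hkd : k < d)
    (hp : ∀ i j, Tendsto (fun t : ℝ => exp (t • gen G w) i j) atTop (𝓝 (p j)))
    {x : State n d k} (hx : x ∈ DQR n d k) :
    x ∈ DQRFull hkd.le G w ↔ KeepsFullRank (propagators (gen G w) p) (product x) := by
  refine ⟨keepsFullRank_of_mem_DQRFull hkd.le hp, fun hfull => ⟨hx, fun P hP => ?_⟩⟩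
  have hprod : product x = fun j => P j * incl d k * x.2 j := by
    funext j
    rw [product, (hP j).2]
  rw [hprod] at hfull
  refine ⟨exists_trajectory hkd.le G w (fun i => (hP i).1) hx.2
    (keepsFullRank_propagators_iff.mp hfull).2, ?_⟩
  rintro Q R hT ⟨hQ0, hR0⟩
  subst hQ0
  rw [← hR0] at hfull
  exact staysAndSynchronizes_of_keepsFullRank hkd hp hT (fun i => (hP i).1)
    (fun i => by rw [hR0]; exact hx.2 i) hfull

theorem continuous_product :
    Continuous (product : State n d k → Fin n → Matrix (Fin d) (Fin k) ℝ) :=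
  continuous_pi fun i => Continuous.matrix_mul ((continuous_apply i).comp continuous_fst)
    ((continuous_apply i).comp continuous_snd)

theorem product_factors {X : Fin n → Matrix (Fin d) (Fin k) ℝ} (hX : ∀ i, FullRank (X i)) :
    product (factors X) = X := funext fun i => (hX i).qFac_mul_rFac

theorem factors_mem_DQR (hkd : k < d) {X : Fin n → Matrix (Fin d) (Fin k) ℝ}
    (hX : ∀ i, FullRank (X i)) : factors X ∈ DQR n d k :=
  ⟨fun i => by
    obtain ⟨P, hP, h⟩ := exists_specialOrthogonal_mul_incl hkd (hX i).qFac_transpose_mul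
    exact ⟨P, hP, h.symm⟩, fun i => (hX i).rFac_mem⟩

theorem factors_product (hkd : k ≤ d) {x : State n d k} (hx : x ∈ DQR n d k) :
    (∀ i, FullRank (product x i)) ∧ factors (product x) = x := by
  have horth : ∀ i, (x.1 i).transpose * x.1 i = 1 := fun i => by
    obtain ⟨P, hP, h⟩ := hx.1 i
    rw [h]
    exact transpose_mul_self_mul_incl hkd (mem_specialOrthogonal_iff.mp hP).1
  have h := fun i => qFac_rFac_mul (horth i) (hx.2 i)
  exact ⟨fun i => fullRank_mul (horth i) (RPlus.det_pos (hx.2 i)).ne',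
    Prod.ext (funext fun i => (h i).1) (funext fun i => (h i).2)⟩

end Characterization

/-! ### The dimension of the exceptional set -/

section Dimension

variable {n d k : ℕ}

/-- The indices of the entries of an `n`-tuple of `d × k` matrices outside column `c` of the `i`-th
matrix. -/
abbrev OtherEntry (n d k : ℕ) (i : Fin n) (c : Fin k) : Type :=
  {q : Fin n × Fin d × Fin k // ¬(q.1 = i ∧ q.2.2 = c)}

theorem card_otherEntry_le (i : Fin n) (c : Fin k) :
    Fintype.card (OtherEntry n d k i c) + d ≤ n * d * k := by
  classical
  have h1 : d ≤ Fintype.card {q : Fin n × Fin d × Fin k // q.1 = i ∧ q.2.2 = c} := by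
    conv_lhs => rw [← Fintype.card_fin d]
    exact Fintype.card_le_of_injective
      (fun a => ⟨(i, a, c), rfl, rfl⟩) fun a b h => by simpa using h
  have h2 := Fintype.card_subtype_compl fun q : Fin n × Fin d × Fin k => q.1 = i ∧ q.2.2 = c
  have h3 := Fintype.card_subtype_le fun q : Fin n × Fin d × Fin k => q.1 = i ∧ q.2.2 = c
  have h4 : Fintype.card (Fin n × Fin d × Fin k) = n * d * k := by simp [mul_assoc]
  rw [h4] at h2 h3
  unfold OtherEntry
  omega

/-- The tuple whose `i`-th matrix has as column `c` the linear combination with coefficients `y` of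
its other columns, all other entries being free. -/
def deficient (i : Fin n) (c : Fin k)
    (y : (OtherEntry n d k i c → ℝ) × ({b : Fin k // b ≠ c} → ℝ)) (j : Fin n) :
    Matrix (Fin d) (Fin k) ℝ :=
  Matrix.of fun a b => if h : j = i ∧ b = c then
    ∑ b' : {b : Fin k // b ≠ c}, y.2 b' * y.1 ⟨(i, a, b'), fun h => b'.2 h.2⟩
  else y.1 ⟨(j, a, b), h⟩

theorem exists_deficient {Z : Fin n → Matrix (Fin d) (Fin k) ℝ} {i : Fin n}
    (hZ : ¬ FullRank (Z i)) : ∃ c y, Z = deficient i c y := by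
  obtain ⟨v, hv, h⟩ := exists_mulVec_eq_zero_of_not_fullRank hZ
  -- Column `c` is a combination of the others as the `c`-th coefficient of a null vector is nonzero.
  obtain ⟨c, hc⟩ := Function.ne_iff.mp hv
  refine ⟨c, (fun q => Z q.1.1 q.1.2.1 q.1.2.2, fun b => -v b / v c), ?_⟩
  ext j a b
  simp only [deficient, Matrix.of_apply]
  split_ifs with hjb
  · obtain ⟨rfl, rfl⟩ := hjb
    have h1 : ∑ b', Z j a b' * v b' = 0 := congrFun h a
    rw [Fintype.sum_eq_add_sum_subtype_ne _ b] at h1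
    have hc' : v b ≠ 0 := hc
    have h2 : ∑ x : {b' // b' ≠ b}, -v x / v b * Z j a x =
        -(∑ x : {b' // b' ≠ b}, Z j a x * v x) / v b := by
      rw [← Finset.sum_neg_distrib, Finset.sum_div]
      exact Finset.sum_congr rfl fun x _ => by ring
    rw [h2, eq_div_iff hc']
    linarith
  · rfl

/-- The images of the tuples whose `i`-th matrix is rank deficient under a smooth one-parameter
family of linear maps have codimension at least `d - k`: rank deficiency has codimension
`d - k + 1`, and the parameter costs one dimension. -/
theorem dimH_mix_deficient_lt (hk : 0 < k) (hkd : k < d) {T : ℝ → Matrix (Fin n) (Fin n) ℝ}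
    (hT : ∀ i j, ContDiff ℝ 1 fun s => T s i j) (i : Fin n) :
    dimH {X : Fin n → Fin d → Fin k → ℝ | ∃ s, ∃ Z : Fin n → Matrix (Fin d) (Fin k) ℝ,
      ¬ FullRank (Z i) ∧ X = mix (T s) Z} < (n * d * k : ℕ) := by
  have hsub : {X : Fin n → Fin d → Fin k → ℝ | ∃ s, ∃ Z : Fin n → Matrix (Fin d) (Fin k) ℝ,
      ¬ FullRank (Z i) ∧ X = mix (T s) Z} ⊆
      ⋃ c : Fin k, range fun (y : ℝ × (OtherEntry n d k i c → ℝ) × ({b : Fin k // b ≠ c} → ℝ))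
        (j : Fin n) (a : Fin d) (b : Fin k) => mix (T y.1) (deficient i c y.2) j a b := by
    rintro X ⟨s, Z, hZ, rfl⟩
    obtain ⟨c, y, rfl⟩ := exists_deficient hZ
    exact mem_iUnion.mpr ⟨c, (s, y), rfl⟩
  refine (dimH_mono hsub).trans_lt ?_
  rw [dimH_iUnion]
  have hpos : 0 < n * d * k := Nat.mul_pos (Nat.mul_pos i.pos (by omega)) hk
  refine (iSup_le fun c => ?_).trans_lt
    (show ((n * d * k - 1 : ℕ) : ENNReal) < (n * d * k : ℕ) by
      exact_mod_cast Nat.sub_lt hpos one_pos)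
  refine (ContDiff.dimH_range_le ?_).trans ?_
  · refine contDiff_pi.mpr fun j => contDiff_pi.mpr fun a => contDiff_pi.mpr fun b => ?_
    simp only [mix_apply]
    refine ContDiff.sum fun l _ => ((hT j l).comp contDiff_fst).mul ?_
    simp only [deficient, Matrix.of_apply]
    split_ifs <;> fun_prop
  · have h1 := card_otherEntry_le (n := n) (d := d) i c
    have h2 : Fintype.card {b : Fin k // b ≠ c} = k - 1 := by
      simp [Fintype.card_subtype_compl]
    rw [Module.finrank_prod, Module.finrank_prod, Module.finrank_fintype_fun_eq_card,
      Module.finrank_fintype_fun_eq_card, Module.finrank_self, h2]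
    exact_mod_cast (by omega)

theorem contDiffAt_entries_factors {X : Fin n → Fin d → Fin k → ℝ}
    (hX : ∀ i, FullRank (Matrix.of (X i))) :
    ContDiffAt ℝ 1 (fun Y : Fin n → Fin d → Fin k → ℝ =>
      entries (factors fun i => Matrix.of (Y i))) X := by
  have hproj : ∀ i, ContDiff ℝ 1 fun Y : Fin n → Fin d → Fin k → ℝ => Y i := fun i => by fun_prop
  refine ContDiffAt.prodMk ?_ ?_
  · exact contDiffAt_pi.mpr fun i => contDiffAt_pi.mpr fun a => contDiffAt_pi.mpr fun b =>
      ContDiffAt.comp (g := fun Y : Fin d → Fin k → ℝ => qFac (Matrix.of Y) a b) X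
        ((contDiffAt_qFac (hX i) a b).of_le (by norm_num)) (hproj i).contDiffAt
  · exact contDiffAt_pi.mpr fun i => contDiffAt_pi.mpr fun a => contDiffAt_pi.mpr fun b =>
      ContDiffAt.comp (g := fun Y : Fin d → Fin k → ℝ => rFac (Matrix.of Y) a b) X
        ((contDiffAt_rFac (hX i) a b).of_le (by norm_num)) (hproj i).contDiffAt

theorem mix_inv_cancel {A B : Matrix (Fin n) (Fin n) ℝ} (h : B * A = 1)
    (X : Fin n → Matrix (Fin d) (Fin k) ℝ) : X = mix B (mix A X) := by
  rw [← mix_mul, h, mix_one]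

/-- The tuples that lose full rank under some propagator, or in the limit, form a set of dimension
less than `n d k`. For the limit, one of the matrices is replaced by the weighted mean, which is an
invertible change of coordinates. -/
theorem dimH_not_keepsFullRank_lt (hk : 0 < k) (hkd : k < d) (hn : 0 < n)
    (H : Matrix (Fin n) (Fin n) ℝ) {p : Fin n → ℝ} (hp1 : ∑ j, p j = 1) :
    dimH {X : Fin n → Fin d → Fin k → ℝ |
      ¬ KeepsFullRank (propagators H p) fun i => Matrix.of (X i)} < (n * d * k : ℕ) := by
  obtain ⟨r, hr⟩ : ∃ r, p r ≠ 0 := by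
    by_contra! h
    simp [h] at hp1
  -- The change of coordinates that replaces the `r`-th matrix by the weighted mean.
  set B := (1 : Matrix (Fin n) (Fin n) ℝ).updateRow r p with hB
  have hBdet : B.det ≠ 0 := by
    have h1 : p = ∑ j, p j • (1 : Matrix (Fin n) (Fin n) ℝ) j := by
      ext l
      simp [Finset.sum_apply, Matrix.one_apply]
    rw [hB, h1, Matrix.det_updateRow_sum]
    simpa using hr
  have hBinv : B⁻¹ * B = 1 := Matrix.nonsing_inv_mul _ hBdet.isUnit
  have hBr : ∀ (X : Fin n → Matrix (Fin d) (Fin k) ℝ) i,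
      mix B X r = mix (Matrix.of fun _ j => p j) X i := fun X i => by
    simp [mix, hB]
  set S : Fin n → Set (Fin n → Fin d → Fin k → ℝ) := fun i =>
    {X | ∃ s : ℝ, ∃ Z : Fin n → Matrix (Fin d) (Fin k) ℝ,
      ¬ FullRank (Z i) ∧ X = mix (exp (s • H)) Z} with hS
  set S' : Set (Fin n → Fin d → Fin k → ℝ) :=
    {X | ∃ _ : ℝ, ∃ Z : Fin n → Matrix (Fin d) (Fin k) ℝ,
      ¬ FullRank (Z r) ∧ X = mix B⁻¹ Z} with hS'
  have hsub : {X : Fin n → Fin d → Fin k → ℝ |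
      ¬ KeepsFullRank (propagators H p) fun i => Matrix.of (X i)} ⊆ (⋃ i, S i) ∪ S' := by
    intro X hX
    rw [mem_ofPred_eq, keepsFullRank_propagators_iff, not_and_or] at hX
    rcases hX with hX | hX
    · push Not at hX
      obtain ⟨i, hi⟩ := hX
      refine .inr ⟨0, mix B fun i => Matrix.of (X i), ?_, mix_inv_cancel hBinv _⟩
      rwa [hBr _ i]
    · push Not at hX
      obtain ⟨t, ht, i, hi⟩ := hX
      refine .inl (mem_iUnion.mpr ⟨i, -t, mix (exp (t • H)) fun i => Matrix.of (X i), hi, ?_⟩)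
      refine mix_inv_cancel ?_ _
      rw [← exp_add_smul, neg_add_cancel, zero_smul, NormedSpace.exp_zero]
  refine (dimH_mono hsub).trans_lt ?_
  rw [dimH_union, dimH_iUnion, max_lt_iff]
  have hSlt : ∀ i, dimH (S i) < (n * d * k : ℕ) := fun i =>
    dimH_mix_deficient_lt hk hkd
      (fun i j => (contDiff_exp_entry H i j).of_le (by norm_num)) i
  refine ⟨?_, dimH_mix_deficient_lt hk hkd (T := fun _ => B⁻¹) (fun _ _ => contDiff_const) r⟩
  have : Nonempty (Fin n) := ⟨⟨0, hn⟩⟩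
  obtain ⟨i₀, hi₀⟩ := Finite.exists_max fun i => dimH (S i)
  exact (iSup_le hi₀).trans_lt (hSlt i₀)

/-- The exceptional set in `D_QR(k)` lies in the image of the exceptional tuples under the locally
Lipschitz QR decomposition. -/
theorem hasMeasureZero_of_dimH_lt (hkd : k ≤ d) {D : Set (State n d k)}
    {B : Set (Fin n → Fin d → Fin k → ℝ)} (hD : D ⊆ DQR n d k) (hDB : ∀ x ∈ D, product x ∈ B)
    (hB : dimH B < (n * d * k : ℕ)) : HasMeasureZero D := by
  set F : (Fin n → Fin d → Fin k → ℝ) → (Fin n → Fin d → Fin k → ℝ) × (Fin n → Fin k → Fin k → ℝ) :=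
    fun Y => entries (factors fun i => Matrix.of (Y i)) with hF
  set B' : Set (Fin n → Fin d → Fin k → ℝ) := {X ∈ B | ∀ i, FullRank (Matrix.of (X i))} with hB'
  have hsub : entries '' D ⊆ F '' B' := by
    rintro _ ⟨x, hx, rfl⟩
    obtain ⟨hfr, hfac⟩ := factors_product hkd (hD hx)
    exact ⟨product x, ⟨hDB x hx, hfr⟩, congrArg entries hfac⟩
  have hle : dimH (F '' B') ≤ dimH B' := dimH_image_le_of_locally_lipschitzOn fun X hX => by
    obtain ⟨C, t, ht, hL⟩ := (contDiffAt_entries_factors hX.2).exists_lipschitzOnWith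
    exact ⟨C, t, mem_nhdsWithin_of_mem_nhds ht, hL⟩
  have hlt : dimH (entries '' D) < (n * d * k : ℕ) :=
    ((dimH_mono hsub).trans (hle.trans (dimH_mono fun X hX => hX.1))).trans_lt hB
  have h0 := hausdorffMeasure_of_dimH_lt (d := ((n * d * k : ℕ) : NNReal)) (by exact_mod_cast hlt)
  rw [HasMeasureZero]
  exact_mod_cast h0

/-- Every point of `D_QR(k)` is the QR decomposition of a tuple near which there are tuples outside
any set of dimension less than `n d k`. -/
theorem exists_factors_mem_of_dimH_lt (hkd : k < d) {B : Set (Fin n → Fin d → Fin k → ℝ)}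
    (hB : dimH B < (n * d * k : ℕ)) {x : State n d k} (hx : x ∈ DQR n d k) {u : Set (State n d k)}
    (hu : u ∈ 𝓝 x) : ∃ y ∈ DQR n d k, y ∈ u ∧ product y ∉ B := by
  obtain ⟨hfr, hfac⟩ := factors_product hkd.le hx
  have hcont : ContinuousAt (factors : (Fin n → Matrix (Fin d) (Fin k) ℝ) → State n d k)
      (product x) := by
    refine ContinuousAt.prodMk (continuousAt_pi.mpr fun i => ?_) (continuousAt_pi.mpr fun i => ?_)
    · exact ContinuousAt.comp (g := qFac) (f := fun X : Fin n → Matrix (Fin d) (Fin k) ℝ => X i)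
        (continuousAt_factors (hfr i)).1 (continuous_apply i).continuousAt
    · exact ContinuousAt.comp (g := rFac) (f := fun X : Fin n → Matrix (Fin d) (Fin k) ℝ => X i)
        (continuousAt_factors (hfr i)).2 (continuous_apply i).continuousAt
  have hnear : ∀ᶠ X in 𝓝 (product x), factors X ∈ u ∧ ∀ i, FullRank (X i) := by
    refine (hcont.eventually_mem (by rwa [hfac])).and (Filter.eventually_all.mpr fun i => ?_)
    exact (continuous_apply i).continuousAt.preimage_mem_nhds (isOpen_fullRank.mem_nhds (hfr i))
  have hdense : Dense Bᶜ := by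
    refine dense_compl_of_dimH_lt_finrank ?_
    have : Module.finrank ℝ (Fin n → Fin d → Fin k → ℝ) = n * d * k := by
      simp [Module.finrank_pi_fintype, mul_assoc]
    rwa [this]
  obtain ⟨X, hX, hXu, hXfr⟩ := hdense.inter_nhds_nonempty hnear
  exact ⟨factors X, factors_mem_DQR hkd hXfr, hXu, by rwa [product_factors hXfr]⟩

end Dimension

end

end ColumnSync

end

theorem proposition1 (n d k : ℕ) (hk : 1 ≤ k) (hkd : k < d)
    (G : Digraph (Fin n)) (hG : ColumnSync.QuasiStronglyConnected G)
    (w : Fin n → Fin n → ℝ) (hw : ∀ i j, G.Adj i j → 0 < w i j) :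
    IsOpen {p : ColumnSync.DQR n d k | (p : ColumnSync.State n d k) ∈
      ColumnSync.DQRFull hkd.le G w} ∧
    ColumnSync.HasMeasureZero (ColumnSync.DQR n d k \ ColumnSync.DQRFull hkd.le G w) ∧
    IsNowhereDense {p : ColumnSync.DQR n d k | (p : ColumnSync.State n d k) ∉
      ColumnSync.DQRFull hkd.le G w} := by
  obtain ⟨r, hr⟩ := hG
  obtain ⟨p, hp1, hp⟩ := ColumnSync.tendsto_exp_smul (ColumnSync.gen_offdiag_nonneg hw)
    ColumnSync.gen_row_sum fun i => ColumnSync.gen_reachable hw (hr i)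
  set K := ColumnSync.propagators (ColumnSync.gen G w) p
  have hmem := fun {x : ColumnSync.State n d k} (hx : x ∈ ColumnSync.DQR n d k) =>
    ColumnSync.mem_DQRFull_iff hkd hp hx
  have hdim := ColumnSync.dimH_not_keepsFullRank_lt hk hkd r.pos (ColumnSync.gen G w) hp1
  have hopen : IsOpen {p : ColumnSync.DQR n d k | (p : ColumnSync.State n d k) ∈
      ColumnSync.DQRFull hkd.le G w} := by
    have h1 : {p : ColumnSync.DQR n d k | (p : ColumnSync.State n d k) ∈
        ColumnSync.DQRFull hkd.le G w} =
        (fun p : ColumnSync.DQR n d k => ColumnSync.product (p : ColumnSync.State n d k)) ⁻¹'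
          {X | ColumnSync.KeepsFullRank K X} := by
      ext x
      exact hmem x.2
    rw [h1]
    exact (ColumnSync.isOpen_keepsFullRank (ColumnSync.isCompact_propagators hp)).preimage
      (ColumnSync.continuous_product.comp continuous_subtype_val)
  refine ⟨hopen, ?_, ?_⟩
  · refine ColumnSync.hasMeasureZero_of_dimH_lt hkd.le Set.sdiff_subset ?_ hdim
    exact fun x hx h => hx.2 ((hmem hx.1).mpr h)
  · have hclosed : IsClosed {p : ColumnSync.DQR n d k | (p : ColumnSync.State n d k) ∉
        ColumnSync.DQRFull hkd.le G w} := hopen.isClosed_compl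
    rw [hclosed.isNowhereDense_iff, Set.eq_empty_iff_forall_notMem]
    intro x hx
    rw [mem_interior_iff_mem_nhds, mem_nhds_subtype] at hx
    obtain ⟨u, hu, hux⟩ := hx
    obtain ⟨y, hyD, hyu, hyB⟩ := ColumnSync.exists_factors_mem_of_dimH_lt hkd hdim x.2 hu
    exact hux (a := ⟨y, hyD⟩) hyu ((hmem hyD).mpr (not_not.mp hyB))
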